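/- Let a group $G$ act by simplicial automorphisms on a simplicial complex $X$ whose geometric realization $|X|$ is simply connected (in particular non-empty and path connected). Assume that $G$ acts without rotations, that is, for every simplex $s$ of $X$, every element of $G$ that maps $s$ to itself fixes every vertex of $s$. Assume moreover that the quotient space $X/G$ (the space of $G$-orbits in $|X|$, with the quotient topology) is $2$-connected, i.e. non-empty and path connected with $\pi_1(X/G)=0$ and $\pi_2(X/G)=0$. For a vertex $v$ of $X$ and an element $g$ of its stabilizer $G_v$, write $g_v$ for $g$ regarded as an element of the factor $G_v$ of the free product $\ast_{v\in X^{(0)}} G_v$ of the stabilizers of all the vertices of $X$. Let $R$ be the normal subgroup of this free product generated by 1. the edge relations $g_v = g_{v'}$, for all pairs of vertices $v,v'$ joined by an edge $e$ of $X$ and all $g\in G$ that stabilize $e$ (such a $g$ lies in $G_v$ and in $G_{v'}$, as the action is without rotations); and 2. the conjugation relations $g_v h_w g_v^{-1} = (ghg^{-1})_{g(w)}$, for all vertices $v,w$ of $X$ and all $g\in G_v$ and $h\in G_w$. Then the canonical homomorphism $\ast_{v\in X^{(0)}} G_v \to G$, $g_v\mapsto g$, induces an isomorphism $$\Big(\mathop{\ast}_{v\in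 X^{(0)}} G_v\Big)\Big/R \;\cong\; G.$$ -/

import Mathlib

open scoped Topology

noncomputable section

namespace AbstractSimplicialComplex

variable {V : Type*}

/-- The geometric realization `|X|` of an abstract simplicial complex `X` with vertex set `V`:
its points are the formal convex combinations of vertices whose support is a simplex of `X`
(barycentric coordinates). -/
@[ext]
structure Realization (X : AbstractSimplicialComplex V) where
  /-- the barycentric coordinates -/
  coord : V →₀ ℝ
  nonneg : ∀ v, 0 ≤ coord v
  sum_eq_one : (coord.sum fun _ t => t) = 1
  support_mem : coord.support ∈ X.faces

/-- The characteristic map of a simplex `s` of `X`, from the standard simplex with vertex set `s`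
to `|X|`: barycentric coordinates on `s` are extended by `0` to the other vertices. -/
def Realization.ofSimplex (X : AbstractSimplicialComplex V) (s : X.faces)
    (p : stdSimplex ℝ (s : Finset V)) : X.Realization where
  coord := (Finsupp.equivFunOnFinite.symm p.1).embDomain
    (Function.Embedding.subtype (· ∈ (s : Finset V)))
  nonneg v := by
    by_cases hv : v ∈ (s : Finset V)
    · have := Finsupp.embDomain_apply_self (Function.Embedding.subtype (· ∈ (s : Finset V)))
        (Finsupp.equivFunOnFinite.symm p.1) ⟨v, hv⟩
      simp only [Function.Embedding.subtype_apply] at this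
      rw [this]
      exact p.2.1 _
    · rw [Finsupp.embDomain_of_notMem_range]
      simpa using hv
  sum_eq_one := by
    rw [Finsupp.sum_embDomain, Finsupp.sum_fintype _ _ (fun _ => rfl)]
    exact p.2.2
  support_mem := by
    refine (X.isRelLowerSet_faces s.2).2 ?_ ?_
    · intro v hv
      rw [Finsupp.support_embDomain, Finset.mem_map] at hv
      obtain ⟨w, -, rfl⟩ := hv
      exact w.2
    · rw [Finsupp.support_embDomain, Finset.map_nonempty, Finsupp.support_nonempty_iff]
      intro h
      have h1 := p.2.2
      have h0 : p.1 = 0 := by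
        ext i
        exact DFunLike.congr_fun h i
      rw [h0] at h1
      simp at h1

/-- The weak (coherent) topology on `|X|`: a set is open if and only if its preimage in every
simplex of `X` is open. -/
instance (X : AbstractSimplicialComplex V) : TopologicalSpace X.Realization :=
  ⨆ s : X.faces, TopologicalSpace.coinduced (Realization.ofSimplex X s) inferInstance

variable (G : Type*) [Group G] [MulAction G V]

/-- The action of `G` on the vertex set `V` is an action on the simplicial complex `X`: every
element of `G` maps simplices to simplices. -/
class IsSimplicialAction (X : AbstractSimplicialComplex V) : Prop where
  map_mem : ∀ (g : G), ∀ s ∈ X.faces, s.map (MulAction.toPerm g).toEmbedding ∈ X.faces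

/-- The action is without rotations: whoever stabilizes a simplex `s` of `X` (as a set)
stabilizes `s` pointwise. -/
def WithoutRotations (X : AbstractSimplicialComplex V) : Prop :=
  ∀ s ∈ X.faces, ∀ g : G, s.map (MulAction.toPerm g).toEmbedding = s → ∀ v ∈ s, g • v = v

/-- The action on `|X|` that extends the action on the vertices linearly over every simplex. -/
instance (X : AbstractSimplicialComplex V) [IsSimplicialAction G X] :
    MulAction G X.Realization where
  smul g x :=
    { coord := Finsupp.equivMapDomain (MulAction.toPerm g) x.coord
      nonneg := fun v => by
        rw [Finsupp.equivMapDomain_apply]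
        exact x.nonneg _
      sum_eq_one := by
        rw [Finsupp.sum_equivMapDomain]
        exact x.sum_eq_one
      support_mem := IsSimplicialAction.map_mem g _ x.support_mem }
  one_smul x := by
    refine Realization.ext (Finsupp.ext fun v => ?_)
    change x.coord ((1 : G)⁻¹ • v) = x.coord v
    rw [inv_one, one_smul]
  mul_smul g h x := by
    refine Realization.ext (Finsupp.ext fun v => ?_)
    change x.coord ((g * h)⁻¹ • v) = x.coord (h⁻¹ • g⁻¹ • v)
    rw [mul_inv_rev, mul_smul]

/-- The quotient space `X/G`, i.e. the set of `G`-orbits in `|X|` with the quotient topology. -/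
abbrev OrbitSpace (X : AbstractSimplicialComplex V) [IsSimplicialAction G X] : Type _ :=
  MulAction.orbitRel.Quotient G X.Realization

variable (V) in
/-- The free product of the stabilizers `G_v`, over all vertices `v`. -/
abbrev StabilizerProduct : Type _ :=
  Monoid.CoprodI fun v : V => MulAction.stabilizer G v

variable {G}

/-- `g_v`: the element `g` of `G_v`, considered as an element of the free product. -/
abbrev stabElt (v : V) (g : MulAction.stabilizer G v) : StabilizerProduct V G :=
  Monoid.CoprodI.of (M := fun v : V => MulAction.stabilizer G v) (i := v) g

/-- For `h` in `G_w`, the element `g h g⁻¹` of `G_{g(w)}`. -/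
def conjStab (g : G) (w : V) (h : MulAction.stabilizer G w) : MulAction.stabilizer G (g • w) :=
  ⟨g * h * g⁻¹, by
    rw [MulAction.mem_stabilizer_iff, smul_smul, inv_mul_cancel_right, mul_smul]
    exact congrArg (g • ·) h.2⟩

variable (G)

/-- The edge relators `g_v (g_{v'})⁻¹`, where `v` and `v'` are the two vertices of an edge `e` of
`X` and `g` stabilizes `e`. (If the action is without rotations, then `g` automatically lies
in `G_v` and in `G_{v'}`.) -/
def edgeRelators (X : AbstractSimplicialComplex V) : Set (StabilizerProduct V G) :=
  {r | ∃ e ∈ X.faces, e.card = 2 ∧ ∃ v ∈ e, ∃ v' ∈ e, v ≠ v' ∧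
    ∃ g : G, e.map (MulAction.toPerm g).toEmbedding = e ∧
    ∃ (hv : g ∈ MulAction.stabilizer G v) (hv' : g ∈ MulAction.stabilizer G v'),
      r = stabElt v ⟨g, hv⟩ * (stabElt v' ⟨g, hv'⟩)⁻¹}

variable (V) in
/-- The conjugation relators `g_v h_w g_v⁻¹ ((g h g⁻¹)_{g(w)})⁻¹`, for all vertices `v`, `w` and
all `g` in `G_v` and `h` in `G_w`. -/
def conjugationRelators : Set (StabilizerProduct V G) :=
  {r | ∃ (v w : V) (g : MulAction.stabilizer G v) (h : MulAction.stabilizer G w),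
    r = stabElt v g * stabElt w h * (stabElt v g)⁻¹ *
      (stabElt ((g : G) • w) (conjStab (g : G) w h))⁻¹}

/-- The normal subgroup `R` generated by the edge relations and the conjugation relations. -/
def relatorSubgroup (X : AbstractSimplicialComplex V) : Subgroup (StabilizerProduct V G) :=
  Subgroup.normalClosure (edgeRelators G X ∪ conjugationRelators V G)

instance (X : AbstractSimplicialComplex V) : (relatorSubgroup G X).Normal :=
  Subgroup.normalClosure_normal

end AbstractSimplicialComplex

/-- A space is `2`-connected if it is non-empty and path connected with trivial fundamental group
(these three are `SimplyConnectedSpace`) and its second homotopy group is trivial. -/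
structure IsTwoConnected (Y : Type*) [TopologicalSpace Y] : Prop where
  simplyConnected : SimplyConnectedSpace Y
  pi_two : ∀ y : Y, Subsingleton (π_ 2 Y y)

end

open AbstractSimplicialComplex

/-!
Let `Γ` be the quotient of the free product by `R`, and let `K` be the kernel of `Γ → G`.

Surjectivity: the image `N` of `Γ` is normal and contains the stabilizers of all simplices. A
`G`-equivariant function from the simplices to `G ⧸ N` therefore exists, and its differences on
the cover of `X` by the open stars of the barycenters form a locally constant Čech cocycle on `X/G`.
As `X/G` is simply connected, this cocycle is trivial, so the function is constant on orbits of
simplices, i.e. `N = G`.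

Injectivity: by the conjugation relations `K` is central, and by the edge relations the stabilizer
of a simplex `s` lifts to a subgroup `D s` of `Γ`. The cover of `X` by the barycentric stars,
indexed by the cosets in `Γ ⧸ D s`, carries a `Γ`-invariant `K`-valued `1`-cochain whose coboundary
descends to a locally constant Čech `2`-cocycle on `X/G`. The transgression of this cocycle to the
loop space of `X/G`, which is simply connected, is trivial. Hence there is a holonomy function on
`Γ`, computed along paths in `X` from a base point `x₀` to `γ x₀`. It is unchanged if `γ` is
multiplied from the left by some `g_v`, since folding the path at the fixed point `v` of `g_v` does
not change its projection to `X/G`; thus it is constant. But it restricts to the identity on `K` up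
to an additive constant, so `K` is trivial.
-/

section Covering

variable {E Z : Type*} [TopologicalSpace E] [TopologicalSpace Z] [SimplyConnectedSpace Z]
  {p : E → Z}

theorem eq_of_joined_of_isCoveringMap (cov : IsCoveringMap p) {e e₁ e₂ : E}
    (h₁ : Joined e e₁) (h₂ : Joined e e₂) (h : p e₁ = p e₂) : e₁ = e₂ := by
  obtain ⟨γ₁⟩ := h₁
  obtain ⟨γ₂⟩ := h₂
  have hlift : ∀ {e' z : E}, Path e e' → ∀ (hz : p e' = p z)
      (δ : Path.Homotopic.Quotient (p e) (p z)), cov.monodromy δ ⟨e, rfl⟩ = ⟨e', hz⟩ :=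
    fun γ hz δ => cov.monodromy_eq_of_map_eq (Path.Homotopic.Quotient.mk γ)
      (Subsingleton.elim _ _)
  have δ : Path.Homotopic.Quotient (p e) (p e₁) := .mk (γ₁.map cov.continuous)
  exact congrArg Subtype.val ((hlift γ₁ rfl δ).symm.trans (hlift γ₂ h.symm δ))

theorem joined_zero_apply (ω : C(unitInterval, E)) (t : unitInterval) : Joined (ω 0) (ω t) :=
  ⟨⟨⟨fun s => ω (s * t), by fun_prop⟩, by simp, by simp⟩⟩

theorem exists_section_continuous_along_paths (cov : IsCoveringMap p) (e₀ : E) :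
    ∃ σ : Z → E, (∀ z, p (σ z) = z) ∧ ∀ ω : C(unitInterval, Z), Continuous (σ ∘ ω) := by
  have hex : ∀ z, ∃ e, Joined e₀ e ∧ p e = z := fun z => by
    obtain ⟨γ⟩ := PathConnectedSpace.joined (p e₀) z
    refine ⟨_, ⟨⟨cov.liftPath γ e₀ γ.source, cov.liftPath_zero .., rfl⟩⟩, ?_⟩
    exact (congrFun (cov.liftPath_lifts γ e₀ γ.source) 1).trans γ.target
  choose σ hσ hpσ using hex
  refine ⟨σ, hpσ, fun ω => ?_⟩
  let Ω := cov.liftPath ω (σ (ω 0)) (hpσ _).symm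
  have hΩ : ∀ t, p (Ω t) = ω t := congrFun (cov.liftPath_lifts ..)
  have hΩ₀ : Ω 0 = σ (ω 0) := cov.liftPath_zero ..
  have hσΩ : σ ∘ ω = Ω := funext fun t =>
    eq_of_joined_of_isCoveringMap cov (hσ (ω t))
      ((hσ (ω 0)).trans (hΩ₀ ▸ joined_zero_apply Ω t)) ((hpσ _).trans (hΩ t).symm)
  exact hσΩ ▸ Ω.continuous

end Covering

section CechCocycle

variable {Z ι Q : Type*} [TopologicalSpace Z] [Group Q]

/-- A locally constant Čech `1`-cocycle with values in `Q` on the open cover `U` of `Z`. The value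
`c i j z` is relevant only for `z ∈ U i ∩ U j`. -/
structure IsCechCocycle (U : ι → Set Z) (c : ι → ι → Z → Q) : Prop where
  isOpen : ∀ i, IsOpen (U i)
  exists_mem : ∀ z, ∃ i, z ∈ U i
  eventually_eq : ∀ {i j z}, z ∈ U i → z ∈ U j → ∀ᶠ z' in 𝓝 z, c i j z' = c i j z
  mul_eq : ∀ {i j k z}, z ∈ U i → z ∈ U j → z ∈ U k → c i j z * c j k z = c i k z

namespace IsCechCocycle

variable {U : ι → Set Z} {c : ι → ι → Z → Q}

/-- The covering space with fiber `Q` whose transition functions are given by a cocycle. -/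
noncomputable def fiberBundleCore [TopologicalSpace Q] [DiscreteTopology Q]
    (hc : IsCechCocycle U c) : FiberBundleCore ι Z Q where
  baseSet := U
  isOpen_baseSet := hc.isOpen
  indexAt z := (hc.exists_mem z).choose
  mem_baseSet_at z := (hc.exists_mem z).choose_spec
  coordChange i j z x := x * c i j z
  coordChange_self i z hz x := by
    rw [mul_eq_left.1 (hc.mul_eq hz hz hz), mul_one]
  continuousOn_coordChange i j := by
    rintro ⟨z, x⟩ ⟨hz, -⟩
    refine (continuousAt_const (y := x * c i j z)).congr ?_ |>.continuousWithinAt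
    have hfst := (continuous_fst.tendsto (z, x)).eventually (hc.eventually_eq hz.1 hz.2)
    have hsnd := (continuous_snd.tendsto (z, x)).eventually_mem
      (mem_nhds_discrete.2 rfl : {x} ∈ 𝓝 x)
    filter_upwards [hfst, hsnd] with w hw₁ hw₂
    rw [hw₁, hw₂]
  coordChange_comp i j k z hz x := by
    rw [mul_assoc, hc.mul_eq hz.1.1 hz.1.2 hz.2]

theorem exists_trivialization [SimplyConnectedSpace Z] (hc : IsCechCocycle U c) :
    ∃ b : ι → Z → Q, (∀ i j z, z ∈ U i → z ∈ U j → b i z * c i j z = b j z) ∧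
      ∀ (ω : C(unitInterval, Z)) i t, ω t ∈ U i → ∀ᶠ t' in 𝓝 t, b i (ω t') = b i (ω t) := by
  let _ : TopologicalSpace Q := ⊥
  have : DiscreteTopology Q := ⟨rfl⟩
  let C := hc.fiberBundleCore
  have cov : IsCoveringMap C.proj := FiberBundle.isCoveringMap (F := Q) (E := C.Fiber)
  obtain ⟨z₀⟩ := (inferInstance : Nonempty Z)
  obtain ⟨σ, hσ, hσ_cont⟩ := exists_section_continuous_along_paths cov ⟨z₀, (1 : Q)⟩
  refine ⟨fun i z => (C.localTriv i (σ z)).2, fun i j z hi hj => ?_, fun ω i t ht => ?_⟩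
  · have hz : C.proj (σ z) = z := hσ z
    have hmem : z ∈ U (C.indexAt z) := C.mem_baseSet_at z
    simp only [FiberBundleCore.localTriv_apply]
    change (show Q from (σ z).2) * c (C.indexAt (C.proj (σ z))) i (C.proj (σ z)) * c i j z =
      (show Q from (σ z).2) * c (C.indexAt (C.proj (σ z))) j (C.proj (σ z))
    rw [hz, mul_assoc, hc.mul_eq hmem hi hj]
  · have hmem : σ (ω t) ∈ (C.localTriv i).source := by
      rw [C.mem_localTriv_source]
      change C.proj (σ (ω t)) ∈ U i
      rwa [hσ]
    have hcont : ContinuousAt (fun t => (C.localTriv i (σ (ω t))).2) t :=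
      continuousAt_snd.comp <| ((C.localTriv i).continuousAt hmem).comp (f := σ ∘ ω)
        (hσ_cont ω).continuousAt
    exact hcont.eventually_mem (mem_nhds_discrete.2 rfl : {_} ∈ 𝓝 _)

end IsCechCocycle

end CechCocycle

section LoopSpace

variable {Y : Type*} [TopologicalSpace Y]

instance pathConnectedSpace_path [SimplyConnectedSpace Y] (x y : Y) :
    PathConnectedSpace (Path x y) where
  nonempty := PathConnectedSpace.joined x y
  joined p q := by
    obtain ⟨H⟩ := SimplyConnectedSpace.paths_homotopic p q
    exact ⟨⟨⟨H.eval, Path.continuous_uncurry_iff.1 H.continuous⟩, by simp, by simp⟩⟩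

/-- The identification of the loops parametrized by a cube with a single coordinate with the
paths, as in `genLoopEquivOfUnique`. -/
noncomputable def genLoopHomeomorphOfUnique (N : Type*) [Unique N] (y : Y) :
    GenLoop N Y y ≃ₜ Path y y where
  toEquiv := genLoopEquivOfUnique N
  continuous_toFun := by
    refine Path.continuous_uncurry_iff.1 ?_
    change Continuous fun w : GenLoop N Y y × unitInterval => w.1 fun _ => w.2
    fun_prop
  continuous_invFun := by
    refine Continuous.subtype_mk (ContinuousMap.continuous_of_continuous_uncurry _ ?_) _
    change Continuous fun w : Path y y × (N → unitInterval) => w.1 (w.2 default)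
    fun_prop

theorem simplyConnectedSpace_of_subsingleton_fundamentalGroup [PathConnectedSpace Y] (y : Y)
    [Subsingleton (FundamentalGroup Y y)] : SimplyConnectedSpace Y := by
  refine simply_connected_iff_loops_nullhomotopic.2 ⟨inferInstance, fun x γ => ?_⟩
  have : Subsingleton (FundamentalGroup Y x) :=
    (FundamentalGroup.fundamentalGroupMulEquivOfPathConnected x y).injective.subsingleton
  exact Path.Homotopic.Quotient.eq.1 (this.elim (.mk γ) (.mk (Path.refl x)))

/-- The nontrivial coordinate `j ≠ 0` of the square. -/
noncomputable instance uniqueNeZeroFinTwo : Unique {j : Fin 2 // j ≠ 0} where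
  default := ⟨1, by decide⟩
  uniq := by decide

theorem IsTwoConnected.simplyConnectedSpace_path (hY : IsTwoConnected Y) (y : Y) :
    SimplyConnectedSpace (Path y y) := by
  have := hY.simplyConnected
  have := hY.pi_two y
  let e := genLoopHomeomorphOfUnique {j : Fin 2 // j ≠ 0} y
  have : PathConnectedSpace (GenLoop {j : Fin 2 // j ≠ 0} Y y) :=
    e.symm.surjective.pathConnectedSpace e.symm.continuous
  have : Subsingleton (FundamentalGroup (GenLoop {j : Fin 2 // j ≠ 0} Y y) GenLoop.const) :=
    (homotopyGroupEquivFundamentalGroup (0 : Fin 2)).symm.injective.subsingleton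
  have := simplyConnectedSpace_of_subsingleton_fundamentalGroup
    (GenLoop.const : GenLoop {j : Fin 2 // j ≠ 0} Y y)
  exact e.symm.toHomotopyEquiv.simplyConnectedSpace

end LoopSpace

section Subdivision

/-- The point `k / n` of the unit interval. -/
noncomputable def node (n k : ℕ) : unitInterval :=
  Set.projIcc 0 1 zero_le_one ((k : ℝ) / n)

/-- The subinterval `[k / n, (k + 1) / n]` of the unit interval, in a form without division. -/
def piece (n k : ℕ) : Set unitInterval :=
  {t | (k : ℝ) ≤ n * t ∧ n * (t : ℝ) ≤ k + 1}

variable {n m k : ℕ}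

theorem mul_node (hn : 0 < n) (hk : k ≤ n) : n * (node n k : ℝ) = k := by
  have hn' : (0 : ℝ) < n := by exact_mod_cast hn
  have hk' : (k : ℝ) ≤ n := by exact_mod_cast hk
  rw [node, Set.projIcc_of_mem zero_le_one ⟨by positivity, (div_le_one hn').2 hk'⟩]
  field_simp

theorem node_mul (hm : 0 < m) (n k : ℕ) : node (n * m) (k * m) = node n k := by
  have hm' : (m : ℝ) ≠ 0 := by exact_mod_cast hm.ne'
  simp only [node, Nat.cast_mul, mul_div_mul_right _ _ hm']

theorem node_mem_piece (hk : k < n) : node n k ∈ piece n k := by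
  have h := mul_node (Nat.zero_lt_of_lt hk) hk.le
  exact ⟨h.ge, by linarith⟩

theorem node_succ_mem_piece (hk : k < n) : node n (k + 1) ∈ piece n k := by
  have h := mul_node (Nat.zero_lt_of_lt hk) (Nat.succ_le_of_lt hk)
  push_cast at h
  exact ⟨by linarith, h.le⟩

theorem zero_mem_piece (n : ℕ) : 0 ∈ piece n 0 := by
  simp [piece]

theorem one_mem_piece (hn : 0 < n) : 1 ∈ piece n (n - 1) := by
  simp [piece, Nat.cast_sub (Nat.one_le_of_lt hn)]

theorem isCompact_piece (n k : ℕ) : IsCompact (piece n k) := by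
  have hmul : Continuous fun t : unitInterval => (n : ℝ) * t := by fun_prop
  exact ((isClosed_le continuous_const hmul).inter
    (isClosed_le hmul continuous_const)).isCompact

theorem isPreconnected_piece (n k : ℕ) : IsPreconnected (piece n k) := by
  refine Set.OrdConnected.isPreconnected ⟨fun x hx y hy z hz => ?_⟩
  have hxz : (x : ℝ) ≤ z := hz.1
  have hzy : (z : ℝ) ≤ y := hz.2
  exact ⟨hx.1.trans (by gcongr), le_trans (by gcongr) hy.2⟩

theorem piece_mul_subset (hm : 0 < m) (n k : ℕ) : piece (n * m) k ⊆ piece n (k / m) := by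
  rintro t ⟨hkt, htk⟩
  have hm' : (0 : ℝ) < m := by exact_mod_cast hm
  have hfloor : ((k / m : ℕ) : ℝ) * m ≤ k := by exact_mod_cast Nat.div_mul_le_self k m
  have hceil : (k : ℝ) + 1 ≤ ((k / m : ℕ) + 1) * m := by
    exact_mod_cast Nat.succ_le_of_lt (Nat.lt_mul_of_div_lt (Nat.lt_succ_self (k / m)) hm)
  push_cast at hkt htk
  exact ⟨le_of_mul_le_mul_right (by linarith) hm', le_of_mul_le_mul_right (by linarith) hm'⟩

theorem dist_le_of_mem_piece (hn : 0 < n) {s t : unitInterval} (hs : s ∈ piece n k)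
    (ht : t ∈ piece n k) : dist s t ≤ 1 / n := by
  have hn' : (0 : ℝ) < n := by exact_mod_cast hn
  rw [Subtype.dist_eq, Real.dist_eq, le_div_iff₀' hn', ← abs_of_pos hn', ← abs_mul,
    mul_sub, abs_le]
  constructor <;> linarith [hs.1, hs.2, ht.1, ht.2]

theorem eventually_piece_subset_ball {δ : ℝ} (hδ : 0 < δ) :
    ∀ᶠ n in Filter.atTop, ∀ k, ∀ t ∈ piece n k, piece n k ⊆ Metric.ball t δ := by
  have hlim : ∀ᶠ n : ℕ in Filter.atTop, 1 / (n : ℝ) < δ :=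
    tendsto_one_div_atTop_nhds_zero_nat.eventually_lt_const hδ
  filter_upwards [hlim, Filter.eventually_gt_atTop 0] with n hnδ hn k t ht s hs
  exact (dist_le_of_mem_piece hn hs ht).trans_lt hnδ

theorem eq_of_eventually_eq_on_piece {Z A : Type*} [TopologicalSpace Z] {p : unitInterval → Z}
    (hp : Continuous p) {f : Z → A}
    (hf : ∀ t ∈ piece n k, ∀ᶠ z in 𝓝 (p t), f z = f (p t)) {s t : unitInterval}
    (hs : s ∈ piece n k) (ht : t ∈ piece n k) : f (p s) = f (p t) := by
  let _ : TopologicalSpace A := ⊥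
  have : DiscreteTopology A := ⟨rfl⟩
  refine (isPreconnected_piece n k).constant (f := f ∘ p) (fun t ht => ?_) hs ht
  refine (continuousAt_const (y := f (p t))).congr ?_ |>.continuousWithinAt
  filter_upwards [hp.continuousAt.eventually (hf t ht)] with t' h using h.symm

end Subdivision

/-- A sequence of `length` labels for the pieces of a subdivision of the unit interval into
`length` intervals of equal size; the values of `label` from `length` on are irrelevant. -/
@[ext]
structure LabelSeq (ι : Type*) where
  /-- the number of pieces -/
  length : ℕ
  /-- the label of the piece `[k / length, (k + 1) / length]` -/
  label : ℕ → ι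

/-- Every piece is subdivided into `m` pieces with the same label. -/
def LabelSeq.refine {ι : Type*} (a : LabelSeq ι) (m : ℕ) : LabelSeq ι where
  length := a.length * m
  label k := a.label (k / m)

theorem LabelSeq.refine_refine {ι : Type*} (a : LabelSeq ι) (m n : ℕ) :
    (a.refine m).refine n = a.refine (m * n) := by
  ext1
  · exact mul_assoc ..
  · funext k
    exact congrArg a.label ((Nat.div_div_eq_div_mul ..).trans (by rw [mul_comm]))

/-- The labels are replaced by their images under `π`. -/
def LabelSeq.map {ι κ : Type*} (π : ι → κ) (a : LabelSeq ι) : LabelSeq κ where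
  length := a.length
  label k := π (a.label k)

/-- The path `p` maps every piece of the subdivision given by `a` into the member of the family `U`
with the label of this piece; the first label is `i` and the last one is `j`. -/
structure IsLabelling {ι Z : Type*} (U : ι → Set Z) (i j : ι) (a : LabelSeq ι)
    (p : unitInterval → Z) : Prop where
  pos : 0 < a.length
  first : a.label 0 = i
  last : a.label (a.length - 1) = j
  mapsTo : ∀ k < a.length, Set.MapsTo p (piece a.length k) (U (a.label k))

theorem mul_sub_one_div_of_pos {m : ℕ} (hm : 0 < m) (k : ℕ) : (k * m - 1) / m = k - 1 := by
  rcases k with _ | k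
  · simp
  · simpa [mul_comm] using Nat.mul_sub_div 0 m (k + 1) (by positivity)

namespace IsLabelling

variable {ι Z : Type*} {U : ι → Set Z} {i j : ι} {a : LabelSeq ι} {p : unitInterval → Z}

theorem source_mem (h : IsLabelling U i j a p) : p 0 ∈ U i :=
  h.first ▸ h.mapsTo 0 h.pos (zero_mem_piece _)

theorem target_mem (h : IsLabelling U i j a p) : p 1 ∈ U j :=
  h.last ▸ h.mapsTo _ (Nat.sub_lt h.pos one_pos) (one_mem_piece h.pos)

theorem mem_left (h : IsLabelling U i j a p) {k : ℕ} (hk : k < a.length) :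
    p (node a.length k) ∈ U (a.label k) :=
  h.mapsTo k hk (node_mem_piece hk)

theorem mem_pred (h : IsLabelling U i j a p) {k : ℕ} (hk : k < a.length) :
    p (node a.length k) ∈ U (a.label (k - 1)) := by
  rcases k with _ | k
  · exact h.mem_left hk
  · exact h.mapsTo k (Nat.lt_of_succ_lt hk) (node_succ_mem_piece (Nat.lt_of_succ_lt hk))

theorem refine (h : IsLabelling U i j a p) {m : ℕ} (hm : 0 < m) :
    IsLabelling U i j (a.refine m) p where
  pos := Nat.mul_pos h.pos hm
  first := by simpa [LabelSeq.refine] using h.first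
  last := by simpa [LabelSeq.refine, mul_sub_one_div_of_pos hm] using h.last
  mapsTo k hk :=
    (h.mapsTo (k / m) (Nat.div_lt_of_lt_mul (by rwa [mul_comm]))).mono_left
      (piece_mul_subset hm _ k)

end IsLabelling

/-- The label sequence for two pieces, with labels `i` and `j`. -/
def LabelSeq.two {ι : Type*} (i j : ι) : LabelSeq ι where
  length := 2
  label k := if k = 0 then i else j

theorem LabelSeq.map_two {ι κ : Type*} (π : ι → κ) (i j : ι) :
    (LabelSeq.two i j).map π = LabelSeq.two (π i) (π j) := by
  ext1
  · rfl
  · funext k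
    exact apply_ite π _ _ _

theorem isLabelling_refl {ι Z : Type*} [TopologicalSpace Z] {U : ι → Set Z} {i j : ι} {z : Z}
    (hi : z ∈ U i) (hj : z ∈ U j) : IsLabelling U i j (LabelSeq.two i j) (Path.refl z) where
  pos := two_pos
  first := rfl
  last := rfl
  mapsTo k _ u _ := by
    change z ∈ U (if k = 0 then i else j)
    split_ifs <;> assumption

section Labelling

variable {ι Z : Type*} [TopologicalSpace Z] {U : ι → Set Z} {x y : Z}

theorem isOpen_setOf_isLabelling (hU : ∀ i, IsOpen (U i)) (i j : ι) (a : LabelSeq ι) :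
    IsOpen {p : Path x y | IsLabelling U i j a p} := by
  refine isOpen_iff_eventually.2 fun p hp => ?_
  have hcont : Continuous fun p : Path x y => (p : C(unitInterval, Z)) := continuous_induced_dom
  have hpiece : ∀ k ∈ Finset.range a.length, ∀ᶠ p' : Path x y in 𝓝 p,
      Set.MapsTo p' (piece a.length k) (U (a.label k)) := fun k hk =>
    hcont.continuousAt.eventually <| ContinuousMap.eventually_mapsTo (isCompact_piece _ k)
      (hU _) (hp.mapsTo k (Finset.mem_range.1 hk))
  filter_upwards [(Finset.range a.length).eventually_all.2 hpiece] with p' hp'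
  exact ⟨hp.pos, hp.first, hp.last, fun k hk => hp' k (Finset.mem_range.2 hk)⟩

theorem eventually_exists_isLabelling (hU : ∀ i, IsOpen (U i)) (hcov : ∀ z, ∃ i, z ∈ U i)
    (p : Path x y) {i j : ι} (hi : x ∈ U i) (hj : y ∈ U j) :
    ∀ᶠ n in Filter.atTop, ∃ L : ℕ → ι, IsLabelling U i j ⟨n, L⟩ p := by
  have hU' : ∀ i, IsOpen (p ⁻¹' U i) := fun i => (hU i).preimage p.continuous
  obtain ⟨δ, hδ, hball⟩ := lebesgue_number_lemma_of_metric isCompact_univ hU'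
    fun t _ => Set.mem_iUnion.2 (hcov (p t))
  obtain ⟨δ₀, hδ₀, hball₀⟩ := Metric.isOpen_iff.1 (hU' i) 0 (by simpa using hi)
  obtain ⟨δ₁, hδ₁, hball₁⟩ := Metric.isOpen_iff.1 (hU' j) 1 (by simpa using hj)
  choose l hl using fun t => hball t (Set.mem_univ t)
  filter_upwards [eventually_piece_subset_ball hδ, eventually_piece_subset_ball hδ₀,
    eventually_piece_subset_ball hδ₁, Filter.eventually_ge_atTop 2] with n hn hn₀ hn₁ hn2
  refine ⟨fun k => if k = 0 then i else if k = n - 1 then j else l (node n k), by simp; omega,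
    by simp, by simp; omega, fun k hk => ?_⟩
  dsimp only at hk ⊢
  split_ifs with hk0 hk1
  · exact hk0 ▸ (hn₀ 0 0 (zero_mem_piece n)).trans hball₀
  · exact hk1 ▸ (hn₁ (n - 1) 1 (one_mem_piece (by omega))).trans hball₁
  · exact (hn k _ (node_mem_piece hk)).trans (hl _)

end Labelling

section Transgression

variable {ι A : Type*} [AddCommGroup A]

/-- The coboundary of the `1`-cochain `τ` on the simplex with vertices `i`, `j`, `k`. -/
def coboundary (τ : ι → ι → A) (i j k : ι) : A :=
  τ i j + τ j k - τ i k

/-- The sum of the values of a `1`-cochain at the changes of label of a sequence. As `0 - 1 = 0`,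
the summand at `0` is `τ i i` for the first label `i`. -/
def jumpSum (τ : ι → ι → A) (a : LabelSeq ι) : A :=
  ∑ k ∈ Finset.range a.length, τ (a.label (k - 1)) (a.label k)

/-- The value of the coboundary of `τ` on the square which arises when one label changes from `i'`
to `i` while another one changes from `j'` to `j`. -/
def nodeTerm (τ : ι → ι → A) (i' i j' j : ι) : A :=
  coboundary τ i' i j - coboundary τ i' j' j

/-- The transgression of the coboundaries of the `1`-cochains `τ y` along the path `p`, for two
label sequences of the same length. -/
noncomputable def nodeSum {Y : Type*} (τ : Y → ι → ι → A) (a b : LabelSeq ι)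
    (p : unitInterval → Y) : A :=
  ∑ k ∈ Finset.range a.length, nodeTerm (τ (p (node a.length k)))
    (a.label (k - 1)) (a.label k) (b.label (k - 1)) (b.label k)

/-- The transgression of the coboundaries of the `1`-cochains `τ y` along the path `p`, for two
label sequences of arbitrary lengths, computed on their common refinement. -/
noncomputable def labelDiff {Y : Type*} (τ : Y → ι → ι → A) (a b : LabelSeq ι)
    (p : unitInterval → Y) : A :=
  nodeSum τ (a.refine b.length) (b.refine a.length) p

theorem nodeTerm_eq (τ : ι → ι → A) (i' i j' j : ι) :
    nodeTerm τ i' i j' j = τ i' i - τ j' j + (τ i j - τ i' j') := by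
  simp only [nodeTerm, coboundary]
  abel

theorem sum_range_mul_of_eq_zero {m : ℕ} (hm : 0 < m) (n : ℕ) {f g : ℕ → A}
    (h : ∀ k, f (k * m) = g k) (h0 : ∀ k r, 0 < r → r < m → f (k * m + r) = 0) :
    ∑ k ∈ Finset.range (n * m), f k = ∑ k ∈ Finset.range n, g k := by
  induction n with
  | zero => simp
  | succ n ih =>
    rw [Nat.succ_mul, Finset.sum_range_add, ih, Finset.sum_range_succ, ← h,
      Finset.sum_eq_single_of_mem 0 (Finset.mem_range.2 hm), add_zero]
    exact fun r hr hr0 => h0 n r (Nat.pos_of_ne_zero hr0) (Finset.mem_range.1 hr)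

theorem mul_add_div_of_lt {m r : ℕ} (k : ℕ) (hr : r < m) : (k * m + r) / m = k := by
  rw [mul_comm, Nat.mul_add_div (Nat.zero_lt_of_lt hr), Nat.div_eq_of_lt hr, add_zero]

theorem mul_add_sub_one_div_of_lt {m r : ℕ} (k : ℕ) (hr0 : 0 < r) (hr : r < m) :
    (k * m + r - 1) / m = k := by
  rw [Nat.add_sub_assoc hr0, mul_add_div_of_lt k ((Nat.sub_le r 1).trans_lt hr)]

theorem jumpSum_refine {τ : ι → ι → A} (hτ : ∀ i, τ i i = 0) (a : LabelSeq ι) {m : ℕ}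
    (hm : 0 < m) : jumpSum τ (a.refine m) = jumpSum τ a := by
  refine sum_range_mul_of_eq_zero hm _ (fun k => ?_) fun k r hr0 hr => ?_
  · simp only [LabelSeq.refine, mul_sub_one_div_of_pos hm, Nat.mul_div_cancel _ hm]
  · simp only [LabelSeq.refine, mul_add_sub_one_div_of_lt k hr0 hr, mul_add_div_of_lt k hr, hτ]

theorem jumpSum_two (τ : ι → ι → A) (i j : ι) : jumpSum τ (LabelSeq.two i j) = τ i i + τ i j := by
  simp [jumpSum, LabelSeq.two, Finset.sum_range_succ]

variable {Y : Type*} {τ : Y → ι → ι → A}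

theorem nodeSum_refine (hτ : ∀ y i, τ y i i = 0) (a b : LabelSeq ι) {m : ℕ} (hm : 0 < m)
    (p : unitInterval → Y) : nodeSum τ (a.refine m) (b.refine m) p = nodeSum τ a b p := by
  refine sum_range_mul_of_eq_zero hm _ (fun k => ?_) fun k r hr0 hr => ?_
  · simp only [LabelSeq.refine, node_mul hm, mul_sub_one_div_of_pos hm, Nat.mul_div_cancel _ hm]
  · simp only [LabelSeq.refine, mul_add_sub_one_div_of_lt k hr0 hr, mul_add_div_of_lt k hr,
      nodeTerm_eq, hτ, sub_self, add_zero]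

theorem labelDiff_eq_nodeSum_refine (hτ : ∀ y i, τ y i i = 0) (a b : LabelSeq ι) {m : ℕ}
    (hm : 0 < m) (p : unitInterval → Y) : labelDiff τ a b p =
      nodeSum τ (a.refine (b.length * m)) (b.refine (a.length * m)) p := by
  rw [labelDiff, ← nodeSum_refine hτ _ _ hm, LabelSeq.refine_refine, LabelSeq.refine_refine]

/-- `τ` is a family of `1`-cochains on an open cover of `Y` whose coboundaries form a locally
constant Čech `2`-cocycle. The cochain `τ y` itself need not depend continuously on `y`. -/
structure IsCechPotential [TopologicalSpace Y] (U : ι → Set Y) (τ : Y → ι → ι → A) : Prop where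
  isOpen : ∀ i, IsOpen (U i)
  exists_mem : ∀ y, ∃ i, y ∈ U i
  self_eq_zero : ∀ y i, τ y i i = 0
  eventually_eq : ∀ {i j k y}, y ∈ U i → y ∈ U j → y ∈ U k →
    ∀ᶠ y' in 𝓝 y, coboundary (τ y') i j k = coboundary (τ y) i j k

variable {U : ι → Set Y} {i j : ι} {a b c : LabelSeq ι}

theorem sum_range_sub_pred {n : ℕ} (hn : 0 < n) (f g : ℕ → A)
    (h : ∀ k, k + 1 < n → g (k + 1) = f k) :
    ∑ k ∈ Finset.range n, (f k - g k) = f (n - 1) - g 0 := by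
  obtain ⟨n, rfl⟩ := Nat.exists_eq_succ_of_ne_zero hn.ne'
  have hg : ∑ k ∈ Finset.range n, g (k + 1) = ∑ k ∈ Finset.range n, f k :=
    Finset.sum_congr rfl fun k hk => h k (by simpa using hk)
  rw [Finset.sum_sub_distrib, Finset.sum_range_succ, Finset.sum_range_succ', hg]
  simp

theorem sum_nodeTerm {τ : ι → ι → A} (hτ : ∀ i, τ i i = 0) (hpos : 0 < a.length)
    (hlen : b.length = a.length) (hfirst : a.label 0 = b.label 0)
    (hlast : a.label (a.length - 1) = b.label (a.length - 1)) :
    ∑ k ∈ Finset.range a.length,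
        nodeTerm τ (a.label (k - 1)) (a.label k) (b.label (k - 1)) (b.label k) =
      jumpSum τ a - jumpSum τ b := by
  have htele : ∑ k ∈ Finset.range a.length,
      (τ (a.label k) (b.label k) - τ (a.label (k - 1)) (b.label (k - 1))) = 0 := by
    rw [sum_range_sub_pred hpos (fun k => τ (a.label k) (b.label k))
      (fun k => τ (a.label (k - 1)) (b.label (k - 1))) fun _ _ => rfl]
    simp [hfirst, hlast, hτ]
  simp only [nodeTerm_eq, Finset.sum_add_distrib, htele, add_zero, Finset.sum_sub_distrib,
    jumpSum, hlen]

namespace IsCechPotential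

variable [TopologicalSpace Y] {p : unitInterval → Y}

theorem nodeSum_add_nodeSum (h : IsCechPotential U τ) (hp : Continuous p)
    (ha : IsLabelling U i j a p) (hb : IsLabelling U i j b p) (hc : IsLabelling U i j c p)
    (hab : b.length = a.length) (hbc : c.length = a.length) :
    nodeSum τ a b p + nodeSum τ b c p = nodeSum τ a c p := by
  let δ : ℕ → ℕ → A := fun k l =>
    coboundary (τ (p (node a.length k))) (a.label l) (b.label l) (c.label l)
  have hconst : ∀ k, k + 1 < a.length → δ (k + 1) k = δ k k := fun k hk => by
    have hk' := Nat.lt_of_succ_lt hk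
    refine eq_of_eventually_eq_on_piece hp
      (f := fun y => coboundary (τ y) (a.label k) (b.label k) (c.label k)) (fun t ht => ?_)
      (node_succ_mem_piece hk') (node_mem_piece hk')
    exact h.eventually_eq (ha.mapsTo k hk' ht) (hb.mapsTo k (hab ▸ hk') (hab ▸ ht))
      (hc.mapsTo k (hbc ▸ hk') (hbc ▸ ht))
  have hends : ∀ k, δ k (a.length - 1) = 0 ∧ δ k 0 = 0 := fun k => by
    simp only [δ, coboundary, ha.first, hb.first, hc.first, ha.last, hab ▸ hb.last, hbc ▸ hc.last,
      h.self_eq_zero, add_zero, sub_self, and_self]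
  have htele : ∑ k ∈ Finset.range a.length, (δ k k - δ k (k - 1)) = 0 := by
    rw [sum_range_sub_pred ha.pos (fun k => δ k k) (fun k => δ k (k - 1)) hconst, (hends _).1,
      (hends _).2, sub_self]
  rw [← sub_eq_zero, ← htele]
  simp only [nodeSum, hab, ← Finset.sum_add_distrib, ← Finset.sum_sub_distrib]
  refine Finset.sum_congr rfl fun k _ => ?_
  simp only [nodeTerm_eq, δ, coboundary]
  abel

theorem labelDiff_add_labelDiff (h : IsCechPotential U τ) (hp : Continuous p)
    (ha : IsLabelling U i j a p) (hb : IsLabelling U i j b p) (hc : IsLabelling U i j c p) :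
    labelDiff τ a b p + labelDiff τ b c p = labelDiff τ a c p := by
  have ha' := ha.refine (Nat.mul_pos hb.pos hc.pos)
  have hb' := hb.refine (Nat.mul_pos ha.pos hc.pos)
  have hc' := hc.refine (Nat.mul_pos ha.pos hb.pos)
  rw [labelDiff_eq_nodeSum_refine h.self_eq_zero a b hc.pos,
    labelDiff_eq_nodeSum_refine h.self_eq_zero b c ha.pos,
    labelDiff_eq_nodeSum_refine h.self_eq_zero a c hb.pos, mul_comm c.length a.length,
    mul_comm c.length b.length, mul_comm b.length a.length]
  refine h.nodeSum_add_nodeSum hp ha' hb' hc' (Nat.mul_left_comm ..) ?_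
  simp only [LabelSeq.refine]
  ring

theorem eventually_nodeSum_eq (h : IsCechPotential U τ) {x y : Y} {p : Path x y}
    (ha : IsLabelling U i j a p) (hb : IsLabelling U i j b p) (hab : b.length = a.length) :
    ∀ᶠ p' : Path x y in 𝓝 p, nodeSum τ a b p' = nodeSum τ a b p := by
  have hnode : ∀ k ∈ Finset.range a.length, ∀ᶠ p' : Path x y in 𝓝 p,
      nodeTerm (τ (p' (node a.length k))) (a.label (k - 1)) (a.label k) (b.label (k - 1))
          (b.label k) =
        nodeTerm (τ (p (node a.length k))) (a.label (k - 1)) (a.label k) (b.label (k - 1))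
          (b.label k) := fun k hk => by
    rw [Finset.mem_range] at hk
    have heval : Continuous fun p' : Path x y => p' (node a.length k) := by fun_prop
    have hb_left : p (node a.length k) ∈ U (b.label k) := hab ▸ hb.mem_left (hab ▸ hk)
    have hb_pred : p (node a.length k) ∈ U (b.label (k - 1)) := hab ▸ hb.mem_pred (hab ▸ hk)
    filter_upwards [
      heval.continuousAt.eventually (h.eventually_eq (ha.mem_pred hk) (ha.mem_left hk) hb_left),
      heval.continuousAt.eventually (h.eventually_eq (ha.mem_pred hk) hb_pred hb_left)]
      with p' h₁ h₂
    rw [nodeTerm, nodeTerm, h₁, h₂]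
  filter_upwards [(Finset.range a.length).eventually_all.2 hnode] with p' hp'
  exact Finset.sum_congr rfl hp'

/-- On a `2`-connected space, the transgression of a locally constant Čech `2`-cocycle to the loop
space is a coboundary, as the loop space is simply connected. -/
theorem exists_loop_trivialization (hY : IsTwoConnected Y) (h : IsCechPotential U τ) {y₀ : Y}
    (hi : y₀ ∈ U i) :
    ∃ f : LabelSeq ι → Path y₀ y₀ → A,
      (∀ a b (p : Path y₀ y₀), IsLabelling U i i a p → IsLabelling U i i b p →
        f a p + labelDiff τ a b p = f b p) ∧
      ∀ (ω : C(unitInterval, Path y₀ y₀)) a t, IsLabelling U i i a (ω t) →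
        ∀ᶠ t' in 𝓝 t, f a (ω t') = f a (ω t) := by
  have := hY.simplyConnectedSpace_path y₀
  have hcocycle : IsCechCocycle (fun a => {p : Path y₀ y₀ | IsLabelling U i i a p})
      fun a b p => Multiplicative.ofAdd (labelDiff τ a b p) :=
    { isOpen := isOpen_setOf_isLabelling h.isOpen i i
      exists_mem := fun p =>
        let ⟨_, _, hL⟩ := (eventually_exists_isLabelling h.isOpen h.exists_mem p hi hi).exists
        ⟨_, hL⟩
      eventually_eq := fun ha hb =>
        (h.eventually_nodeSum_eq (ha.refine hb.pos) (hb.refine ha.pos) (mul_comm ..)).mono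
          fun _ => congrArg Multiplicative.ofAdd
      mul_eq := fun {a b c p} ha hb hc =>
        congrArg Multiplicative.ofAdd (h.labelDiff_add_labelDiff p.continuous ha hb hc) }
  obtain ⟨f, hf, hf_loc⟩ := hcocycle.exists_trivialization
  exact ⟨fun a p => (f a p).toAdd,
    fun a b p ha hb => congrArg Multiplicative.toAdd (hf a b p ha hb),
    fun ω a t ha => (hf_loc ω a t ha).mono fun _ => congrArg Multiplicative.toAdd⟩

end IsCechPotential

end Transgression

theorem eq_of_eventually_eq_along_paths {X A : Type*} [TopologicalSpace X] [PathConnectedSpace X]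
    {f : X → A} (hf : ∀ (ω : C(unitInterval, X)) t, ∀ᶠ t' in 𝓝 t, f (ω t') = f (ω t))
    (x y : X) : f x = f y := by
  obtain ⟨γ⟩ := PathConnectedSpace.joined x y
  simpa using ((IsLocallyConstant.iff_eventually_eq _).2 (hf γ)).apply_eq_of_preconnectedSpace 0 1

section Descent

variable {X Y T ι : Type*}

/-- The family on the base of `q : X → Y`, indexed by `ι`, which is covered by the family `W` on
`X`, indexed by `T`, along `π : T → ι`. -/
def imageCover (q : X → Y) (π : T → ι) (W : T → Set X) (i : ι) : Set Y :=
  ⋃ t ∈ π ⁻¹' {i}, q '' W t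

/-- `W` is an open cover of `X` that lifts the cover `imageCover q π W` of `Y`: every member of
the latter containing `y` lifts to a member of `W` containing any prescribed point over `y`. -/
structure IsLiftedCover [TopologicalSpace X] (q : X → Y) (π : T → ι) (W : T → Set X) :
    Prop where
  isOpen : ∀ t, IsOpen (W t)
  exists_mem : ∀ x, ∃ t, x ∈ W t
  exists_lift : ∀ {t x x'}, x ∈ W t → q x' = q x → ∃ t', π t' = π t ∧ x' ∈ W t'

/-- The value of the coboundary of `τ` at labels of members of `W` with a common point depends only
on the images of this point and of the labels. -/
def CoboundaryDescends {A : Type*} [AddCommGroup A] (q : X → Y) (π : T → ι) (W : T → Set X)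
    (τ : T → T → A) : Prop :=
  ∀ ⦃x x' r r' s s' t t'⦄, q x = q x' → π r = π r' → π s = π s' → π t = π t' →
    x ∈ W r → x ∈ W s → x ∈ W t → x' ∈ W r' → x' ∈ W s' → x' ∈ W t' →
    coboundary τ r s t = coboundary τ r' s' t'

theorem mem_imageCover {q : X → Y} {π : T → ι} {W : T → Set X} {x : X} {t : T} (h : x ∈ W t) :
    q x ∈ imageCover q π W (π t) :=
  Set.mem_biUnion rfl (Set.mem_image_of_mem q h)

theorem IsLabelling.map {q : X → Y} {π : T → ι} {W : T → Set X} {s t : T} {a : LabelSeq T}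
    {p : unitInterval → X} (h : IsLabelling W s t a p) :
    IsLabelling (imageCover q π W) (π s) (π t) (a.map π) (q ∘ p) where
  pos := h.pos
  first := congrArg π h.first
  last := congrArg π h.last
  mapsTo k hk _ hu := mem_imageCover (h.mapsTo k hk hu)

namespace IsLiftedCover

variable [TopologicalSpace X] {q : X → Y} {π : T → ι} {W : T → Set X}

theorem exists_mem_imageCover (h : IsLiftedCover q π W) (hq : q.Surjective) (y : Y) :
    ∃ i, y ∈ imageCover q π W i := by
  obtain ⟨x, rfl⟩ := hq y
  obtain ⟨t, ht⟩ := h.exists_mem x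
  exact ⟨π t, mem_imageCover ht⟩

theorem exists_section (h : IsLiftedCover q π W) (hq : q.Surjective) :
    ∃ (σ : Y → X) (l : Y → ι → T), (∀ y, q (σ y) = y) ∧
      ∀ y i, y ∈ imageCover q π W i → π (l y i) = i ∧ σ y ∈ W (l y i) := by
  choose σ hσ using hq
  have hl : ∀ y i, ∃ t, y ∈ imageCover q π W i → π t = i ∧ σ y ∈ W t := fun y i => by
    by_cases hy : y ∈ imageCover q π W i
    · simp only [imageCover, Set.mem_iUnion, Set.mem_image] at hy
      obtain ⟨t, rfl, x, hx, rfl⟩ := hy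
      obtain ⟨t', ht', hx'⟩ := h.exists_lift hx (hσ (q x))
      exact ⟨t', fun _ => ⟨ht', hx'⟩⟩
    · exact ⟨(h.exists_mem (σ y)).choose, fun hy' => absurd hy' hy⟩
  choose l hl using hl
  exact ⟨σ, l, hσ, hl⟩

variable [TopologicalSpace Y]

theorem isOpen_imageCover (h : IsLiftedCover q π W) (hq : IsOpenMap q) (i : ι) :
    IsOpen (imageCover q π W i) :=
  isOpen_biUnion fun t _ => hq _ (h.isOpen t)

/-- If the quotients `(f s)⁻¹ * f t` descend to `Y`, then so does `f`: over the simply connected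
space `Y` these quotients are trivialized by functions `b i`, and the function `b (π t) * (f t)⁻¹`
on the connected space `X` is constant. -/
theorem apply_eq_of_simplyConnectedSpace [PathConnectedSpace X] [SimplyConnectedSpace Y]
    {Q : Type*} [Group Q] (h : IsLiftedCover q π W) (hq : IsOpenQuotientMap q) {f : T → Q}
    (hf : ∀ {x x' s s' t t'}, q x = q x' → π s = π s' → π t = π t' → x ∈ W s → x ∈ W t →
      x' ∈ W s' → x' ∈ W t' → (f s)⁻¹ * f t = (f s')⁻¹ * f t')
    {x x' : X} {t t' : T} (hx : x ∈ W t) (hx' : x' ∈ W t') (hxx' : q x = q x')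
    (htt' : π t = π t') : f t = f t' := by
  obtain ⟨σ, l, hσ, hl⟩ := h.exists_section hq.surjective
  have hc : ∀ {z s t}, z ∈ W s → z ∈ W t →
      (f (l (q z) (π s)))⁻¹ * f (l (q z) (π t)) = (f s)⁻¹ * f t := fun hs ht =>
    have hls := hl _ _ (mem_imageCover hs)
    have hlt := hl _ _ (mem_imageCover ht)
    hf (hσ _) hls.1 hlt.1 hls.2 hlt.2 hs ht
  have hcocycle : IsCechCocycle (imageCover q π W) fun i j y => (f (l y i))⁻¹ * f (l y j) :=
    { isOpen := h.isOpen_imageCover hq.isOpenMap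
      exists_mem := h.exists_mem_imageCover hq.surjective
      eventually_eq := fun {i j y} hi hj => by
        obtain ⟨hi, hyi⟩ := hl y i hi
        obtain ⟨hj, hyj⟩ := hl y j hj
        have hnhds := hq.isOpenMap.image_mem_nhds
          (((h.isOpen _).inter (h.isOpen _)).mem_nhds ⟨hyi, hyj⟩)
        rw [hσ] at hnhds
        filter_upwards [hnhds]
        rintro _ ⟨z, ⟨hzi, hzj⟩, rfl⟩
        simpa only [hi, hj] using hc hzi hzj
      mul_eq := fun _ _ _ => by group }
  obtain ⟨b, hb, hb_loc⟩ := hcocycle.exists_trivialization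
  choose r hr using h.exists_mem
  let g : X → Q := fun z => b (π (r z)) (q z) * (f (r z))⁻¹
  have hg : ∀ {z t}, z ∈ W t → g z = b (π t) (q z) * (f t)⁻¹ := fun {z t} ht => by
    rw [← hb _ _ _ (mem_imageCover (hr z)) (mem_imageCover ht), hc (hr z) ht]
    simp only [g]
    group
  have hg_const : g x = g x' := eq_of_eventually_eq_along_paths (fun ω u => by
    have hu := hr (ω u)
    filter_upwards [ω.continuous.continuousAt.eventually_mem ((h.isOpen _).mem_nhds hu),
      hb_loc ⟨q ∘ ω, hq.continuous.comp ω.continuous⟩ _ u (mem_imageCover hu)] with u' hu' hbu'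
    rw [hg hu', hg hu]
    exact congrArg (· * _) hbu') x x'
  rw [hg hx, hg hx', hxx', htt'] at hg_const
  exact inv_injective (mul_left_cancel hg_const)

variable {A : Type*} [AddCommGroup A] {τ : T → T → A}

theorem exists_isCechPotential (h : IsLiftedCover q π W) (hq : IsOpenQuotientMap q)
    (hτ : ∀ t, τ t t = 0) (hdesc : CoboundaryDescends q π W τ) :
    ∃ τ' : Y → ι → ι → A, IsCechPotential (imageCover q π W) τ' ∧
      ∀ {x r s t}, x ∈ W r → x ∈ W s → x ∈ W t →
        coboundary (τ' (q x)) (π r) (π s) (π t) = coboundary τ r s t := by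
  obtain ⟨σ, l, hσ, hl⟩ := h.exists_section hq.surjective
  let τ' : Y → ι → ι → A := fun y i j => τ (l y i) (l y j)
  have hτ' : ∀ {x r s t}, x ∈ W r → x ∈ W s → x ∈ W t →
      coboundary (τ' (q x)) (π r) (π s) (π t) = coboundary τ r s t := fun hr hs ht =>
    have hlr := hl _ _ (mem_imageCover hr)
    have hls := hl _ _ (mem_imageCover hs)
    have hlt := hl _ _ (mem_imageCover ht)
    hdesc (hσ _) hlr.1 hls.1 hlt.1 hlr.2 hls.2 hlt.2 hr hs ht
  refine ⟨τ', ⟨h.isOpen_imageCover hq.isOpenMap, h.exists_mem_imageCover hq.surjective,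
    fun y i => hτ _, fun {i j k y} hi hj hk => ?_⟩, hτ'⟩
  obtain ⟨hi, hyi⟩ := hl y i hi
  obtain ⟨hj, hyj⟩ := hl y j hj
  obtain ⟨hk, hyk⟩ := hl y k hk
  have hnhds := hq.isOpenMap.image_mem_nhds
    ((((h.isOpen _).inter (h.isOpen _)).inter (h.isOpen _)).mem_nhds ⟨⟨hyi, hyj⟩, hyk⟩)
  rw [hσ] at hnhds
  filter_upwards [hnhds]
  rintro _ ⟨z, ⟨⟨hzi, hzj⟩, hzk⟩, rfl⟩
  have := hτ' hzi hzj hzk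
  rwa [hi, hj, hk] at this

end IsLiftedCover

section Holonomy

variable {A : Type*} [AddCommGroup A] {q : X → Y} {π : T → ι} {W : T → Set X}
  {τ : T → T → A} {τ' : Y → ι → ι → A} {s t : T} {a b : LabelSeq T} {p : unitInterval → X}

theorem nodeSum_map (hτ : ∀ t, τ t t = 0)
    (hτ' : ∀ {x r s t}, x ∈ W r → x ∈ W s → x ∈ W t →
      coboundary (τ' (q x)) (π r) (π s) (π t) = coboundary τ r s t)
    (ha : IsLabelling W s t a p) (hb : IsLabelling W s t b p) (hab : b.length = a.length) :
    nodeSum τ' (a.map π) (b.map π) (q ∘ p) = jumpSum τ a - jumpSum τ b := by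
  have hlast : a.label (a.length - 1) = b.label (a.length - 1) := by
    rw [ha.last, ← hb.last, hab]
  refine (Finset.sum_congr rfl fun k hk => ?_).trans
    (sum_nodeTerm hτ ha.pos hab (ha.first.trans hb.first.symm) hlast)
  have hk : k < a.length := Finset.mem_range.1 hk
  have hb_left : p (node a.length k) ∈ W (b.label k) := hab ▸ hb.mem_left (hab ▸ hk)
  have hb_pred : p (node a.length k) ∈ W (b.label (k - 1)) := hab ▸ hb.mem_pred (hab ▸ hk)
  simp only [nodeTerm, LabelSeq.map, Function.comp_apply,
    hτ' (ha.mem_pred hk) (ha.mem_left hk) hb_left, hτ' (ha.mem_pred hk) hb_pred hb_left]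

theorem labelDiff_map (hτ : ∀ t, τ t t = 0)
    (hτ' : ∀ {x r s t}, x ∈ W r → x ∈ W s → x ∈ W t →
      coboundary (τ' (q x)) (π r) (π s) (π t) = coboundary τ r s t)
    (ha : IsLabelling W s t a p) (hb : IsLabelling W s t b p) :
    labelDiff τ' (a.map π) (b.map π) (q ∘ p) = jumpSum τ a - jumpSum τ b := by
  have hrefine := nodeSum_map hτ hτ' (ha.refine hb.pos) (hb.refine ha.pos) (Nat.mul_comm ..)
  rwa [jumpSum_refine hτ a hb.pos, jumpSum_refine hτ b ha.pos] at hrefine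

variable [TopologicalSpace X] [TopologicalSpace Y]

/-- The loop in `Y` below a path in `X` whose end points lie in the same fiber of `q`. -/
def projLoop {x y : X} (hq : Continuous q) (hxy : q y = q x) (p : Path x y) :
    Path (q x) (q x) :=
  (p.map hq).cast rfl hxy.symm

theorem continuous_projLoop {x y : X} (hq : Continuous q) (hxy : q y = q x) :
    Continuous (projLoop hq hxy : Path x y → _) := by
  refine Path.continuous_uncurry_iff.1 ?_
  change Continuous fun w : Path x y × unitInterval => q (w.1 w.2)
  fun_prop

theorem IsLabelling.projLoop {x y : X} (hq : Continuous q) (hxy : q y = q x) (hst : π t = π s)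
    {p : Path x y} (h : IsLabelling W s t a p) :
    IsLabelling (imageCover q π W) (π s) (π s) (a.map π) (projLoop hq hxy p) := by
  have hmap := h.map (q := q) (π := π)
  rwa [hst] at hmap

theorem exists_labelling_value [SimplyConnectedSpace X] (h : IsLiftedCover q π W)
    (hq : Continuous q) {x₀ x : X} (hx : q x = q x₀) (ht : π t = π s)
    {f : LabelSeq ι → Path (q x₀) (q x₀) → A}
    (hf : ∀ a b (p : Path x₀ x), IsLabelling W s t a p → IsLabelling W s t b p →
      f (a.map π) (projLoop hq hx p) + jumpSum τ a = f (b.map π) (projLoop hq hx p) + jumpSum τ b)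
    (hf_loc : ∀ (ω : C(unitInterval, Path (q x₀) (q x₀))) a u,
      IsLabelling (imageCover q π W) (π s) (π s) a (ω u) →
        ∀ᶠ u' in 𝓝 u, f a (ω u') = f a (ω u)) :
    ∃ v : A, ∀ a (p : Path x₀ x), IsLabelling W s t a p →
      f (a.map π) (projLoop hq hx p) + jumpSum τ a = v := by
  by_cases hne : ∃ a, ∃ p : Path x₀ x, IsLabelling W s t a p
  swap
  · exact ⟨0, fun a p hap => absurd ⟨a, p, hap⟩ hne⟩
  obtain ⟨a₀, p₀, h₀⟩ := hne
  have hex : ∀ p : Path x₀ x, ∃ a, IsLabelling W s t a p := fun p =>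
    let ⟨_, _, hL⟩ := (eventually_exists_isLabelling h.isOpen h.exists_mem p
      (by simpa using h₀.source_mem) (by simpa using h₀.target_mem)).exists
    ⟨_, hL⟩
  choose L hL using hex
  let g : Path x₀ x → A := fun p => f ((L p).map π) (projLoop hq hx p) + jumpSum τ (L p)
  refine ⟨g p₀, fun a p hap => (hf _ _ p hap (hL p)).trans ?_⟩
  refine eq_of_eventually_eq_along_paths (f := g) (fun ω u => ?_) p p₀
  filter_upwards [ω.continuous.continuousAt.eventually_mem
      ((isOpen_setOf_isLabelling h.isOpen s t (L (ω u))).mem_nhds (hL (ω u))),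
    hf_loc ⟨fun u => projLoop hq hx (ω u), (continuous_projLoop hq hx).comp ω.continuous⟩ _ u
      ((hL (ω u)).projLoop hq hx ht)]
    with u' hu' hfu'
  exact (hf _ _ _ (hL (ω u')) hu').trans (congrArg (· + _) hfu')

/-- The holonomy `B x t` is the sum of the jumps of `τ` along a labelled path from `(x₀, t₀)` to
`(x, t)`, corrected by the trivialization of the transgression on the loop below this path. -/
theorem exists_holonomy [SimplyConnectedSpace X] (hY : IsTwoConnected Y)
    (h : IsLiftedCover q π W) (hq : IsOpenQuotientMap q) (hτ : ∀ t, τ t t = 0)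
    (hdesc : CoboundaryDescends q π W τ) {x₀ : X} {t₀ : T} (h₀ : x₀ ∈ W t₀) :
    ∃ B : X → T → A, ∀ {x₁ x₂ t₁ t₂ a₁ a₂} (p₁ : Path x₀ x₁) (p₂ : Path x₀ x₂),
      IsLabelling W t₀ t₁ a₁ p₁ → IsLabelling W t₀ t₂ a₂ p₂ → q x₁ = q x₀ → π t₁ = π t₀ →
      q ∘ p₁ = q ∘ p₂ → a₁.map π = a₂.map π →
      B x₁ t₁ - B x₂ t₂ = jumpSum τ a₁ - jumpSum τ a₂ := by
  obtain ⟨τ', hτ', hττ'⟩ := h.exists_isCechPotential hq hτ hdesc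
  obtain ⟨f, hf, hf_loc⟩ := hτ'.exists_loop_trivialization hY (mem_imageCover h₀)
  have hvalue : ∀ x t, ∃ v : A, ∀ (hx : q x = q x₀), π t = π t₀ → ∀ a (p : Path x₀ x),
      IsLabelling W t₀ t a p →
      f (a.map π) (projLoop hq.continuous hx p) + jumpSum τ a = v := fun x t => by
    by_cases hxt : q x = q x₀ ∧ π t = π t₀
    · obtain ⟨v, hv⟩ := exists_labelling_value h hq.continuous hxt.1 hxt.2 (τ := τ)
        (fun a b p ha hb => by
          have hf_ab := hf (a.map π) (b.map π) (projLoop hq.continuous hxt.1 p)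
            (ha.projLoop _ _ hxt.2) (hb.projLoop _ _ hxt.2)
          have hdiff : labelDiff τ' (a.map π) (b.map π) (projLoop hq.continuous hxt.1 p) =
            jumpSum τ a - jumpSum τ b := labelDiff_map (q := q) hτ hττ' ha hb
          rw [← hf_ab, hdiff]
          abel) hf_loc
      exact ⟨v, fun _ _ => hv⟩
    · exact ⟨0, fun hx ht => absurd ⟨hx, ht⟩ hxt⟩
  choose B hB using hvalue
  refine ⟨B, fun {x₁ x₂ t₁ t₂ a₁ a₂} p₁ p₂ h₁ h₂ hx ht hp ha => ?_⟩
  have hx' : q x₂ = q x₀ := by simpa [hx] using (congrFun hp 1).symm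
  have ht' : π t₂ = π t₀ := by
    rw [← ht, ← (h₁.map (q := q) (π := π)).last, ha]
    exact (h₂.map (q := q)).last.symm
  have hloop : projLoop hq.continuous hx p₁ = projLoop hq.continuous hx' p₂ :=
    Path.ext hp
  rw [← hB x₁ t₁ hx ht a₁ p₁ h₁, ← hB x₂ t₂ hx' ht' a₂ p₂ h₂, ha, hloop]
  abel

end Holonomy

end Descent

section Orbits

variable {G Γ X T S : Type*} [Group G] [Group Γ] [MulAction G X] [MulAction Γ T] [MulAction G S]

/-- The projection of a `G`-set to its set of orbits. -/
abbrev toOrbit (G : Type*) {X : Type*} [Group G] [MulAction G X] (x : X) :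
    MulAction.orbitRel.Quotient G X :=
  Quotient.mk (MulAction.orbitRel G X) x

theorem toOrbit_eq_iff {x y : X} : toOrbit G x = toOrbit G y ↔ ∃ g : G, g • y = x :=
  Quotient.eq

theorem toOrbit_smul (g : G) (x : X) : toOrbit G (g • x) = toOrbit G x :=
  toOrbit_eq_iff.2 ⟨g, rfl⟩

theorem exists_equivariant {Q : Type*} [Group Q] (c : G →* Q) :
    ∃ f : X → Q, ∀ x, MulAction.stabilizer G x ≤ c.ker → ∀ g : G, f (g • x) = c g * f x := by
  have hrep : ∀ x : X, ∃ g : G, g • (toOrbit G x).out = x := fun x =>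
    toOrbit_eq_iff.1 (Quotient.out_eq _).symm
  choose r hr using hrep
  refine ⟨fun x => c (r x), fun x hx g => ?_⟩
  have hstab : g⁻¹ * r (g • x) * (r x)⁻¹ ∈ MulAction.stabilizer G x := by
    have hgx := hr (g • x)
    rw [toOrbit_smul] at hgx
    rw [MulAction.mem_stabilizer_iff, mul_smul, mul_smul, inv_smul_eq_iff.2 (hr x).symm, hgx,
      inv_smul_smul]
  have hker := hx hstab
  rwa [MonoidHom.mem_ker, map_mul, map_mul, map_inv, map_inv, mul_inv_eq_one,
    inv_mul_eq_iff_eq_mul] at hker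

variable [TopologicalSpace X]

/-- An open cover of the `G`-space `X` by a family, indexed by a `Γ`-set, which is equivariant
along `φ : Γ → G`. -/
structure IsEquivariantCover (φ : Γ →* G) (W : T → Set X) : Prop where
  isOpen : ∀ t, IsOpen (W t)
  exists_mem : ∀ x, ∃ t, x ∈ W t
  smul_mem : ∀ (γ : Γ) {t x}, x ∈ W t → φ γ • x ∈ W (γ • t)

theorem IsEquivariantCover.isLiftedCover {φ : Γ →* G} {W : T → Set X}
    (h : IsEquivariantCover φ W) (hφ : Function.Surjective φ) :
    IsLiftedCover (toOrbit G : X → _) (toOrbit Γ : T → _) W where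
  isOpen := h.isOpen
  exists_mem := h.exists_mem
  exists_lift {t x x'} hx hxx' := by
    obtain ⟨g, rfl⟩ := toOrbit_eq_iff.1 hxx'
    obtain ⟨γ, rfl⟩ := hφ g
    exact ⟨γ • t, toOrbit_smul γ t, h.smul_mem γ hx⟩

/-- An equivariant open cover of a `G`-space whose members are equal to or disjoint from their
translates; equality is understood as equality of indices. -/
structure IsSliceCover (G : Type*) {X S : Type*} [Group G] [MulAction G X] [MulAction G S]
    [TopologicalSpace X] (W : S → Set X) : Prop
    extends IsEquivariantCover (MonoidHom.id G) W where
  smul_eq : ∀ {g : G} {s x}, x ∈ W s → x ∈ W (g • s) → g • s = s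

theorem IsSliceCover.eq_smul {W : S → Set X} (h : IsSliceCover G W) {g : G} {x : X} {s s' : S}
    (hss' : toOrbit G s = toOrbit G s') (hs : g • x ∈ W s) (hs' : x ∈ W s') : s = g • s' := by
  obtain ⟨k, rfl⟩ := toOrbit_eq_iff.1 hss'
  have hk : (k * g⁻¹) • g • s' = k • s' := by rw [smul_smul, inv_mul_cancel_right]
  rw [← hk] at hs ⊢
  exact h.smul_eq (h.smul_mem g hs') hs

theorem IsSliceCover.eq_top_of_stabilizer_le [PathConnectedSpace X] [ContinuousConstSMul G X]
    [SimplyConnectedSpace (MulAction.orbitRel.Quotient G X)] {W : S → Set X}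
    (h : IsSliceCover G W) (N : Subgroup G) [N.Normal]
    (hN : ∀ s : S, MulAction.stabilizer G s ≤ N) : N = ⊤ := by
  obtain ⟨f, hf⟩ := exists_equivariant (X := S) (QuotientGroup.mk' N)
  replace hf := fun s => hf s (by simpa using hN s)
  obtain ⟨x⟩ := (inferInstance : Nonempty X)
  obtain ⟨s, hs⟩ := h.exists_mem x
  refine (Subgroup.eq_top_iff' N).2 fun g => ?_
  have hfg : f (g • s) = f s :=
    (h.isLiftedCover Function.surjective_id).apply_eq_of_simplyConnectedSpace
      MulAction.isOpenQuotientMap_quotientMk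
      (fun {x x' s s' t t'} hxx' hss' htt' hs ht hs' ht' => by
        obtain ⟨g, rfl⟩ := toOrbit_eq_iff.1 hxx'
        rw [h.eq_smul hss' hs hs', h.eq_smul htt' ht ht', hf, hf]
        group)
      (h.smul_mem g hs) hs (toOrbit_smul g x) (toOrbit_smul g s)
  rwa [hf, mul_eq_right, QuotientGroup.mk'_apply, QuotientGroup.eq_one_iff] at hfg

end Orbits

section Folding

theorem node_eq_half {n k : ℕ} (hk : 0 < k) (h : n = 2 * k) : (node n k : ℝ) = 1 / 2 := by
  have hnode := mul_node (n := n) (k := k) (by omega) (by omega)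
  have hk' : (k : ℝ) ≠ 0 := by exact_mod_cast hk.ne'
  have hn : (n : ℝ) = 2 * k := by exact_mod_cast h
  rw [hn] at hnode
  field_simp
  exact mul_left_cancel₀ hk' (by linarith)

variable {G Γ X T : Type*} [Group G] [Group Γ] [MulAction G X] [MulAction Γ T]
  [TopologicalSpace X] [ContinuousConstSMul G X] {x y z : X}

theorem trans_apply_half {u : unitInterval} (hu : (u : ℝ) = 1 / 2) (α : Path x z) (β : Path z y) :
    α.trans β u = z := by
  simp only [Path.trans_apply, hu, le_refl, dif_pos]
  convert α.target using 2
  norm_num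

/-- The concatenation of a path from `x` to `z` with the translate of a path from `z` to `y` by an
element that fixes `z`. -/
noncomputable def foldedPath {g : G} (α : Path x z) (β : Path z y) (hz : g • z = z) :
    Path x (g • y) :=
  α.trans ((β.map (continuous_const_smul g)).cast hz.symm rfl)

theorem foldedPath_apply_of_le {g : G} (α : Path x z) (β : Path z y) (hz : g • z = z)
    {u : unitInterval} (hu : (u : ℝ) ≤ 1 / 2) : foldedPath α β hz u = α.trans β u := by
  rw [foldedPath, Path.trans_apply, Path.trans_apply, dif_pos hu, dif_pos hu]

theorem foldedPath_apply_of_ge {g : G} (α : Path x z) (β : Path z y) (hz : g • z = z)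
    {u : unitInterval} (hu : 1 / 2 ≤ (u : ℝ)) : foldedPath α β hz u = g • α.trans β u := by
  rcases hu.eq_or_lt with hu | hu
  · rw [foldedPath_apply_of_le α β hz hu.ge, trans_apply_half hu.symm, hz]
  · rw [foldedPath, Path.trans_apply, Path.trans_apply, dif_neg hu.not_ge, dif_neg hu.not_ge]
    rfl

theorem toOrbit_foldedPath {g : G} (α : Path x z) (β : Path z y) (hz : g • z = z) :
    (toOrbit G : X → _) ∘ foldedPath α β hz = toOrbit G ∘ α.trans β := by
  funext u
  rcases le_total (u : ℝ) (1 / 2) with hu | hu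
  · exact congrArg _ (foldedPath_apply_of_le α β hz hu)
  · exact (congrArg _ (foldedPath_apply_of_ge α β hz hu)).trans (toOrbit_smul _ _)

/-- The labels of the pieces in the second half of the unit interval are translated by `η`. -/
def LabelSeq.fold (a : LabelSeq T) (η : Γ) : LabelSeq T where
  length := a.length
  label k := if 2 * k < a.length then a.label k else η • a.label k

theorem LabelSeq.map_fold (a : LabelSeq T) (η : Γ) :
    (a.fold η).map (toOrbit Γ) = a.map (toOrbit Γ) := by
  ext1
  · rfl
  · funext k
    simp only [LabelSeq.map, LabelSeq.fold]
    split_ifs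
    · rfl
    · exact toOrbit_smul _ _

variable {W : T → Set X} {φ : Γ →* G} {η : Γ} {s t : T} {a : LabelSeq T} {α : Path x z}
  {β : Path z y}

theorem IsLabelling.fold (hW : IsEquivariantCover φ W) (hz : φ η • z = z) (heven : Even a.length)
    (h : IsLabelling W s t a (α.trans β)) :
    IsLabelling W s (η • t) (a.fold η) (foldedPath α β hz) where
  pos := h.pos
  first := by simpa [LabelSeq.fold, h.pos] using h.first
  last := by
    have hlast : ¬ 2 * (a.length - 1) < a.length := by
      have := h.pos
      grind
    simp only [LabelSeq.fold, if_neg hlast, h.last]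
  mapsTo k hk u hu := by
    have hn : (0 : ℝ) < a.length := by exact_mod_cast h.pos
    have hku : (k : ℝ) ≤ a.length * u := hu.1
    have huk : a.length * (u : ℝ) ≤ k + 1 := hu.2
    have hmem := h.mapsTo k hk hu
    simp only [LabelSeq.fold]
    split_ifs with hk2
    · have hk2' : 2 * ((k : ℝ) + 1) ≤ a.length := by
        have : 2 * (k + 1) ≤ a.length := by grind
        exact_mod_cast this
      rwa [foldedPath_apply_of_le α β hz (by nlinarith)]
    · have hk2' : (a.length : ℝ) ≤ 2 * k := by exact_mod_cast not_lt.1 hk2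
      rw [foldedPath_apply_of_ge α β hz (by nlinarith)]
      exact hW.smul_mem η hmem

end Folding

section CentralExtension

variable {G Γ K X T : Type*} [Group G] [Group Γ] [CommGroup K] [MulAction G X] [MulAction Γ T]
  {i : K →* Γ} {φ : Γ →* G} {W : T → Set X}

/-- An equivariant cover whose members are equal to or disjoint from their translates, with indices
which the central subgroup `i K` of `Γ` permutes freely. The last condition says more: if a coset of
`i K` meets the stabilizers of the indices of two intersecting members, it meets them in the same
element. -/
structure IsCentralSliceCover [TopologicalSpace X] (i : K →* Γ) (φ : Γ →* G) (W : T → Set X) : Prop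
    extends IsEquivariantCover φ W where
  exists_smul_eq : ∀ {γ : Γ} {t x}, x ∈ W t → x ∈ W (γ • t) → ∃ k, γ • t = i k • t
  eq_one : ∀ {γ : Γ} {k t t' x}, x ∈ W t → x ∈ W t' → γ • t = t → (i k * γ) • t' = t' → k = 1

/-- A `1`-cochain with values in `K` which is invariant under `Γ` and changes by the difference of
`k` and `k'` if its arguments are translated by the central elements `i k` and `i k'`. -/
structure IsEquivariantCochain (i : K →* Γ) (W : T → Set X) (τ : T → T → Additive K) : Prop where
  self_eq_zero : ∀ t, τ t t = 0
  smul_smul : ∀ {x t t'}, x ∈ W t → x ∈ W t' → ∀ (γ : Γ) k k',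
    τ (i k • γ • t) (i k' • γ • t') = τ t t' + (Additive.ofMul k' - Additive.ofMul k)

theorem IsEquivariantCochain.smul {τ : T → T → Additive K} (h : IsEquivariantCochain i W τ) {x : X}
    {t t' : T} (ht : x ∈ W t) (ht' : x ∈ W t') (γ : Γ) : τ (γ • t) (γ • t') = τ t t' := by
  simpa using h.smul_smul ht ht' γ 1 1

namespace IsCentralSliceCover

variable [TopologicalSpace X]

theorem exists_cochain (hi : ∀ k γ, i k * γ = γ * i k) (h : IsCentralSliceCover i φ W) :
    ∃ τ : T → T → Additive K, IsEquivariantCochain i W τ := by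
  let _ : MulAction (Γ × K) (T × T) :=
    { smul := fun m ω => (m.1 • ω.1, (i m.2 * m.1) • ω.2)
      one_smul := fun ω => by
        change (_, _) = _
        simp
      mul_smul := fun m n ω => Prod.ext (mul_smul _ _ _) <| by
        change (i (m.2 * n.2) * (m.1 * n.1)) • ω.2 = (i m.2 * m.1) • (i n.2 * n.1) • ω.2
        rw [smul_smul, map_mul]
        congr 1
        rw [mul_assoc, mul_assoc, ← mul_assoc (i n.2), hi n.2 m.1, mul_assoc] }
  obtain ⟨f, hf⟩ := exists_equivariant (X := T × T) (MonoidHom.snd Γ K)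
  have hstab : ∀ {x t t'}, x ∈ W t → x ∈ W t' →
      MulAction.stabilizer (Γ × K) (t, t') ≤ (MonoidHom.snd Γ K).ker := fun hx hx' m hm =>
    h.eq_one hx hx' (congrArg Prod.fst hm) (congrArg Prod.snd hm)
  have hsmul : ∀ {x t t'}, x ∈ W t → x ∈ W t' → ∀ (γ : Γ) k k',
      f (i k • γ • t, i k' • γ • t') = k' * k⁻¹ * f (t, t') := fun {x t t'} ht ht' γ k k' => by
    refine Eq.trans (congrArg f (Prod.ext (smul_smul ..) ?_))
      (hf (t, t') (hstab ht ht') (i k * γ, k' * k⁻¹))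
    change i k' • γ • t' = (i (k' * k⁻¹) * (i k * γ)) • t'
    rw [smul_smul, ← mul_assoc, ← map_mul, inv_mul_cancel_right]
  refine ⟨fun t t' => Additive.ofMul (f (t, t') / f (t, t)), fun t => ?_,
    fun {x t t'} ht ht' γ k k' => ?_⟩
  · rw [div_self', ofMul_one]
  · rw [hsmul ht ht', hsmul ht ht, ← ofMul_div, ← ofMul_mul]
    congr 1
    rw [mul_inv_cancel, one_mul, mul_div_assoc, mul_comm, div_eq_mul_inv k']

theorem eq_smul (h : IsCentralSliceCover i φ W) {γ : Γ} {x : X}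
    {t t' : T} (htt' : toOrbit Γ t = toOrbit Γ t') (ht : φ γ • x ∈ W t) (ht' : x ∈ W t') :
    ∃ k, t = i k • γ • t' := by
  obtain ⟨δ, rfl⟩ := toOrbit_eq_iff.1 htt'
  have hδ : (δ * γ⁻¹) • γ • t' = δ • t' := by rw [smul_smul, inv_mul_cancel_right]
  rw [← hδ] at ht ⊢
  exact h.exists_smul_eq (h.smul_mem γ ht') ht

theorem coboundaryDescends (h : IsCentralSliceCover i φ W)
    (hφ : Function.Surjective φ) {τ : T → T → Additive K} (hτ : IsEquivariantCochain i W τ) :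
    CoboundaryDescends (toOrbit G : X → _) (toOrbit Γ : T → _) W τ := by
  intro x x' r r' s s' t t' hx hr hs ht hxr hxs hxt hxr' hxs' hxt'
  obtain ⟨g, rfl⟩ := toOrbit_eq_iff.1 hx
  obtain ⟨γ, rfl⟩ := hφ g
  obtain ⟨kr, rfl⟩ := h.eq_smul hr hxr hxr'
  obtain ⟨ks, rfl⟩ := h.eq_smul hs hxs hxs'
  obtain ⟨kt, rfl⟩ := h.eq_smul ht hxt hxt'
  simp only [coboundary, hτ.smul_smul hxr' hxs', hτ.smul_smul hxs' hxt', hτ.smul_smul hxr' hxt']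
  abel

end IsCentralSliceCover

variable [TopologicalSpace X] {x y z : X} {s t : T} {a : LabelSeq T} {α : Path x z}
  {β : Path z y} {τ : T → T → Additive K} {η : Γ}

theorem IsEquivariantCochain.jumpSum_fold (hτ : IsEquivariantCochain i W τ)
    (hη : ∀ t, z ∈ W t → η • t = t) (heven : Even a.length)
    (h : IsLabelling W s t a (α.trans β)) : jumpSum τ (a.fold η) = jumpSum τ a := by
  refine Finset.sum_congr rfl fun k hk => ?_
  have hk : k < a.length := Finset.mem_range.1 hk
  simp only [LabelSeq.fold]
  by_cases hk2 : 2 * k < a.length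
  · rw [if_pos hk2, if_pos (by omega)]
  have hpred : (if 2 * (k - 1) < a.length then a.label (k - 1) else η • a.label (k - 1)) =
      η • a.label (k - 1) := by
    split_ifs with hk1
    · have hmem := h.mem_pred hk
      rw [trans_apply_half (node_eq_half (by omega) (by grind))] at hmem
      exact (hη _ hmem).symm
    · rfl
  rw [if_neg hk2, hpred, hτ.smul (h.mem_pred hk) (h.mem_left hk)]

namespace IsCentralSliceCover

variable [SimplyConnectedSpace X] [ContinuousConstSMul G X]

/-- The holonomy around the loop below a path from `x₀` to `γ x₀` is not affected by folding the
path at a fixed point of an element `η` as in the first condition, and it detects `K`. -/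
theorem exists_holonomy_map (h : IsCentralSliceCover i φ W)
    (hY : IsTwoConnected (MulAction.orbitRel.Quotient G X)) (hi : ∀ k γ, i k * γ = γ * i k)
    (hφ : Function.Surjective φ) (hφi : ∀ k, φ (i k) = 1) :
    ∃ b : Γ → Additive K,
      (∀ η z, φ η • z = z → (∀ t, z ∈ W t → η • t = t) → ∀ γ, b (η * γ) = b γ) ∧
      ∀ k, b (i k) = b 1 + Additive.ofMul k := by
  obtain ⟨τ, hτ⟩ := h.exists_cochain hi
  obtain ⟨x₀⟩ := (inferInstance : Nonempty X)
  obtain ⟨t₀, h₀⟩ := h.exists_mem x₀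
  obtain ⟨B, hB⟩ := exists_holonomy hY (h.isLiftedCover hφ)
    MulAction.isOpenQuotientMap_quotientMk hτ.self_eq_zero (h.coboundaryDescends hφ hτ) h₀
  refine ⟨fun γ => B (φ γ • x₀) (γ • t₀), fun η z hz hη γ => ?_, fun k => ?_⟩
  · obtain ⟨α⟩ := PathConnectedSpace.joined x₀ z
    obtain ⟨β⟩ := PathConnectedSpace.joined z (φ γ • x₀)
    obtain ⟨N, hN⟩ := Filter.eventually_atTop.1 <|
      eventually_exists_isLabelling h.isOpen h.exists_mem (α.trans β) h₀ (h.smul_mem γ h₀)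
    obtain ⟨L, hL⟩ := hN (2 * N) (by omega)
    have heven : Even (2 * N) := even_two_mul N
    have hfold := hB (foldedPath α β hz) (α.trans β)
      (hL.fold h.toIsEquivariantCover hz heven) hL
      ((toOrbit_smul _ _).trans (toOrbit_smul _ _)) ((toOrbit_smul _ _).trans (toOrbit_smul _ _))
      (toOrbit_foldedPath α β hz) (LabelSeq.map_fold _ _)
    rw [hτ.jumpSum_fold hη heven hL, sub_self, sub_eq_zero] at hfold
    simpa only [map_mul, mul_smul] using hfold
  · have hk₀ : x₀ ∈ W (i k • t₀) := by simpa [hφi] using h.smul_mem (i k) h₀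
    have hk := hB (Path.refl x₀) (Path.refl x₀) (isLabelling_refl h₀ hk₀) (isLabelling_refl h₀ h₀)
      rfl (toOrbit_smul _ _) rfl (by simp only [LabelSeq.map_two, toOrbit_smul])
    have hτk : τ t₀ (i k • t₀) = Additive.ofMul k := by
      simpa [hτ.self_eq_zero] using hτ.smul_smul h₀ h₀ 1 1 k
    rw [jumpSum_two, jumpSum_two, hτ.self_eq_zero, hτk] at hk
    simpa [hφi, sub_eq_iff_eq_add'] using hk

theorem subsingleton (h : IsCentralSliceCover i φ W)
    (hY : IsTwoConnected (MulAction.orbitRel.Quotient G X)) (hi : ∀ k γ, i k * γ = γ * i k)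
    (hφ : Function.Surjective φ) (hφi : ∀ k, φ (i k) = 1)
    (hgen : Subgroup.closure {η | ∃ z, φ η • z = z ∧ ∀ t, z ∈ W t → η • t = t} = ⊤) :
    Subsingleton K := by
  obtain ⟨b, hb, hbk⟩ := h.exists_holonomy_map hY hi hφ hφi
  have hconst : ∀ η γ, b (η * γ) = b γ := fun η => by
    induction (hgen ▸ Subgroup.mem_top η : η ∈ Subgroup.closure _) using
      Subgroup.closure_induction with
    | mem η hη =>
      obtain ⟨z, hz, hzη⟩ := hη
      exact hb η z hz hzη
    | one => simp
    | mul η η' _ _ hη hη' => simp [mul_assoc, hη, hη']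
    | inv η _ hη => exact fun γ => by rw [← hη (η⁻¹ * γ), mul_inv_cancel_left]
  refine subsingleton_of_forall_eq 1 fun k => ?_
  have hk := hbk k
  rwa [← mul_one (i k), hconst, left_eq_add, ofMul_eq_zero] at hk

end IsCentralSliceCover

end CentralExtension

section StabilizerLift

variable {G Γ X S : Type*} [Group G] [Group Γ] [MulAction G S] {φ : Γ →* G} {D : S → Subgroup Γ}
  {W : S → Set X}

/-- A lift of the stabilizers of the indices `s` along `φ : Γ → G` to subgroups `D s` of `Γ`,
equivariant under conjugation, such that the lifts for two intersecting members of `W` agree on the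
elements that stabilize both indices. -/
structure IsStabilizerLift (φ : Γ →* G) (D : S → Subgroup Γ) (W : S → Set X) : Prop where
  map_eq : ∀ s, (D s).map φ = MulAction.stabilizer G s
  eq_one : ∀ {s a}, a ∈ D s → φ a = 1 → a = 1
  conj_mem : ∀ (γ : Γ) {s a}, a ∈ D s → γ * a * γ⁻¹ ∈ D (φ γ • s)
  mem_of_mem : ∀ {s s' a x}, x ∈ W s → x ∈ W s' → a ∈ D s → φ a • s' = s' → a ∈ D s'

namespace IsStabilizerLift

theorem map_smul (h : IsStabilizerLift φ D W) {s : S} {a : Γ} (ha : a ∈ D s) : φ a • s = s :=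
  (h.map_eq s).le ⟨a, ha, rfl⟩

theorem conj_mem_iff (h : IsStabilizerLift φ D W) {γ : Γ} {s : S} {a : Γ} :
    γ⁻¹ * a * γ ∈ D s ↔ a ∈ D (φ γ • s) := by
  refine ⟨fun ha => ?_, fun ha => ?_⟩
  · simpa [mul_assoc] using h.conj_mem γ ha
  · simpa [mul_assoc] using h.conj_mem γ⁻¹ ha

/-- The map to `S` from the disjoint union of the `Γ`-sets `Γ ⧸ D s` that sends the coset of `1` in
`Γ ⧸ D s` to `s`. -/
def index (h : IsStabilizerLift φ D W) (t : Σ s, Γ ⧸ D s) : S :=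
  Quotient.liftOn' t.2 (fun δ => φ δ • t.1) fun δ δ' hδ => by
    have hstab := h.map_smul (QuotientGroup.leftRel_apply.1 hδ)
    rwa [map_mul, map_inv, mul_smul, inv_smul_eq_iff, eq_comm] at hstab

theorem index_smul (h : IsStabilizerLift φ D W) (γ : Γ) (t : Σ s, Γ ⧸ D s) :
    h.index (γ • t) = φ γ • h.index t := by
  obtain ⟨s, δ⟩ := t
  induction δ using QuotientGroup.induction_on with | _ δ =>
  change φ (γ * δ) • s = φ γ • φ δ • s
  rw [map_mul, mul_smul]

theorem smul_eq_iff (h : IsStabilizerLift φ D W) {γ : Γ} {t : Σ s, Γ ⧸ D s} :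
    γ • t = t ↔ γ ∈ D (h.index t) := by
  obtain ⟨s, δ⟩ := t
  induction δ using QuotientGroup.induction_on with | _ δ =>
  change (⟨s, ((γ * δ : Γ) : Γ ⧸ D s)⟩ : Σ s, Γ ⧸ D s) = ⟨s, δ⟩ ↔ γ ∈ D (φ δ • s)
  rw [Sigma.mk.injEq, heq_eq_eq, eq_comm (a := ((γ * δ : Γ) : Γ ⧸ D s)), QuotientGroup.eq,
    ← mul_assoc, h.conj_mem_iff]
  exact and_iff_right rfl

variable [MulAction G X] [TopologicalSpace X]

theorem isCentralSliceCover {K : Type*} [CommGroup K] {i : K →* Γ} (hi : Function.Injective i)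
    (hrange : i.range = φ.ker) (h : IsStabilizerLift φ D W) (hW : IsSliceCover G W) :
    IsCentralSliceCover i φ (W ∘ h.index) where
  isOpen t := hW.isOpen _
  exists_mem x := by
    obtain ⟨s, hs⟩ := hW.exists_mem x
    exact ⟨⟨s, (1 : Γ)⟩, by simpa [index] using hs⟩
  smul_mem γ t x hx := by
    rw [Function.comp_apply, h.index_smul]
    exact hW.smul_mem (φ γ) hx
  exists_smul_eq {γ t x} hx hγx := by
    rw [Function.comp_apply, h.index_smul] at hγx
    obtain ⟨a, ha, haγ⟩ : φ γ ∈ (D (h.index t)).map φ :=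
      (h.map_eq _).ge (hW.smul_eq hx hγx)
    obtain ⟨k, hk⟩ : γ * a⁻¹ ∈ i.range := by
      rw [hrange, MonoidHom.mem_ker, map_mul, map_inv, haγ, mul_inv_cancel]
    exact ⟨k, by rw [hk, mul_smul, inv_smul_eq_iff.2 (h.smul_eq_iff.2 ha).symm]⟩
  eq_one {γ k t t' x} hx hx' hγ hkγ := by
    rw [h.smul_eq_iff] at hγ hkγ
    have hk : φ (i k) = 1 := hrange.le ⟨k, rfl⟩
    have hγ' : γ ∈ D (h.index t') := h.mem_of_mem hx hx' hγ <| by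
      simpa [hk] using h.map_smul hkγ
    exact hi ((h.eq_one ((mul_mem_cancel_right hγ').1 hkγ) hk).trans (map_one i).symm)

theorem injective [SimplyConnectedSpace X] [ContinuousConstSMul G X]
    (h : IsStabilizerLift φ D W) (hW : IsSliceCover G W)
    (hY : IsTwoConnected (MulAction.orbitRel.Quotient G X)) (hφ : Function.Surjective φ)
    (hcenter : φ.ker ≤ Subgroup.center Γ)
    (hgen : Subgroup.closure {η | ∃ z, φ η • z = z ∧ ∀ s, z ∈ W s → η ∈ D s} = ⊤) :
    Function.Injective φ := by
  have hcomm : ∀ (k : φ.ker) (γ : Γ), (k : Γ) * γ = γ * k := fun k γ =>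
    (Subgroup.mem_center_iff.1 (hcenter k.2) γ).symm
  let _ : CommGroup φ.ker := { mul_comm := fun k k' => Subtype.ext (hcomm k k') }
  have hcover : IsCentralSliceCover φ.ker.subtype φ (W ∘ h.index) :=
    h.isCentralSliceCover Subtype.val_injective φ.ker.range_subtype hW
  have := hcover.subsingleton hY hcomm hφ (fun k => k.2) <| top_unique <| hgen.ge.trans <|
    Subgroup.closure_mono fun η ⟨z, hz, hη⟩ => ⟨z, hz, fun t ht => h.smul_eq_iff.2 (hη _ ht)⟩
  exact (MonoidHom.ker_eq_bot_iff φ).1 φ.ker.eq_bot_of_subsingleton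

end IsStabilizerLift

end StabilizerLift

section BarycentricStars

variable {V : Type*} {X : AbstractSimplicialComplex V}

theorem coord_ofSimplex_of_mem (s : X.faces) (p : stdSimplex ℝ (s : Finset V)) {v : V}
    (hv : v ∈ (s : Finset V)) : (Realization.ofSimplex X s p).coord v = p.1 ⟨v, hv⟩ :=
  Finsupp.embDomain_apply_self (Function.Embedding.subtype (· ∈ (s : Finset V)))
    (Finsupp.equivFunOnFinite.symm p.1) ⟨v, hv⟩

theorem coord_ofSimplex_of_notMem (s : X.faces) (p : stdSimplex ℝ (s : Finset V)) {v : V}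
    (hv : v ∉ (s : Finset V)) : (Realization.ofSimplex X s p).coord v = 0 :=
  Finsupp.embDomain_of_notMem_range _ _ _ (by simpa using hv)

theorem continuous_coord_ofSimplex (s : X.faces) (v : V) :
    Continuous fun p => (Realization.ofSimplex X s p).coord v := by
  by_cases hv : v ∈ (s : Finset V)
  · simp_rw [coord_ofSimplex_of_mem s _ hv]
    exact (continuous_apply _).comp continuous_subtype_val
  · simp_rw [coord_ofSimplex_of_notMem s _ hv]
    exact continuous_const

/-- The open star of the barycenter of `s` in the barycentric subdivision: the points all of whose
coordinates at vertices of `s` are positive and larger than those at the other vertices. -/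
def barycentricStar (X : AbstractSimplicialComplex V) (s : X.faces) : Set X.Realization :=
  {x | ∀ v ∈ (s : Finset V), 0 < x.coord v ∧ ∀ w ∉ (s : Finset V), x.coord w < x.coord v}

theorem isOpen_barycentricStar (s : X.faces) : IsOpen (barycentricStar X s) := by
  classical
  refine isOpen_iSup_iff.2 fun t => isOpen_coinduced.2 ?_
  have hpre : Realization.ofSimplex X t ⁻¹' barycentricStar X s =
      ⋂ v ∈ (s : Finset V), ({p | 0 < (Realization.ofSimplex X t p).coord v} ∩
        ⋂ w ∈ (t : Finset V).filter (· ∉ (s : Finset V)),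
          {p | (Realization.ofSimplex X t p).coord w < (Realization.ofSimplex X t p).coord v}) := by
    ext p
    simp only [barycentricStar, Set.mem_preimage, Set.mem_ofPred_eq, Set.mem_iInter,
      Set.mem_inter_iff, Finset.mem_filter]
    refine forall₂_congr fun v _ => and_congr_right fun hpos => ⟨fun h w hw => h w hw.2,
      fun h w hw => ?_⟩
    by_cases hwt : w ∈ (t : Finset V)
    · exact h w ⟨hwt, hw⟩
    · rwa [coord_ofSimplex_of_notMem t p hwt]
  rw [hpre]
  refine isOpen_biInter_finset fun v _ => IsOpen.inter ?_ (isOpen_biInter_finset fun w _ => ?_)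
  · exact isOpen_lt continuous_const (continuous_coord_ofSimplex t v)
  · exact isOpen_lt (continuous_coord_ofSimplex t w) (continuous_coord_ofSimplex t v)

theorem mem_barycentricStar_support (x : X.Realization) :
    x ∈ barycentricStar X ⟨x.coord.support, x.support_mem⟩ := fun v hv => by
  have hpos : 0 < x.coord v := (x.nonneg v).lt_of_ne (Finsupp.mem_support_iff.1 hv).symm
  exact ⟨hpos, fun w hw => by rwa [Finsupp.notMem_support_iff.1 hw]⟩

theorem subset_or_subset_of_mem_barycentricStar {s t : X.faces} {x : X.Realization}
    (hs : x ∈ barycentricStar X s) (ht : x ∈ barycentricStar X t) :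
    (s : Finset V) ⊆ t ∨ (t : Finset V) ⊆ s := by
  by_contra! h
  obtain ⟨v, hvs, hvt⟩ := Finset.not_subset.1 h.1
  obtain ⟨w, hwt, hws⟩ := Finset.not_subset.1 h.2
  exact lt_asymm ((hs v hvs).2 w hws) ((ht w hwt).2 v hvt)

/-- The vertex `v` as a point of the realization. -/
noncomputable def vertexPoint (X : AbstractSimplicialComplex V) (v : V) : X.Realization where
  coord := Finsupp.single v 1
  nonneg := Finsupp.single_nonneg.2 zero_le_one
  sum_eq_one := Finsupp.sum_single_index rfl
  support_mem := by
    rw [Finsupp.support_single v one_ne_zero]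
    exact X.singleton_mem v

theorem eq_of_vertexPoint_mem_barycentricStar {s : X.faces} {v w : V}
    (h : vertexPoint X v ∈ barycentricStar X s) (hw : w ∈ (s : Finset V)) : w = v := by
  by_contra hwv
  exact (h w hw).1.ne' (Finsupp.single_eq_of_ne hwv)

end BarycentricStars

section SimplicialAction

variable {G V : Type*} [Group G] [MulAction G V] {X : AbstractSimplicialComplex V}
  [IsSimplicialAction G X]

/-- The induced action on the set of simplices. -/
instance instMulActionFaces : MulAction G X.faces where
  smul g s := ⟨_, IsSimplicialAction.map_mem g _ s.2⟩
  one_smul s := Subtype.ext <| by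
    ext v
    change v ∈ Finset.map _ _ ↔ _
    simp
  mul_smul g h s := Subtype.ext <| by
    ext v
    change v ∈ Finset.map _ _ ↔ v ∈ Finset.map _ (Finset.map _ _)
    simp [mul_smul]

theorem coe_smul_face (g : G) (s : X.faces) :
    ((g • s : X.faces) : Finset V) = (s : Finset V).map (MulAction.toPerm g).toEmbedding :=
  rfl

theorem mem_smul_face {g : G} {s : X.faces} {v : V} :
    v ∈ ((g • s : X.faces) : Finset V) ↔ g⁻¹ • v ∈ (s : Finset V) := by
  rw [coe_smul_face, Finset.mem_map_equiv]
  rfl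

theorem smul_mem_smul_face {g : G} {s : X.faces} {v : V} (hv : v ∈ (s : Finset V)) :
    g • v ∈ ((g • s : X.faces) : Finset V) :=
  mem_smul_face.2 (by rwa [inv_smul_smul])

theorem smul_coord (g : G) (x : X.Realization) (v : V) : (g • x).coord v = x.coord (g⁻¹ • v) :=
  rfl

theorem smul_vertexPoint (g : G) (v : V) : g • vertexPoint X v = vertexPoint X (g • v) :=
  Realization.ext (Finsupp.equivMapDomain_single ..)

/-- The map from the vertices of `s` to those of `g • s`. -/
def smulVertex (g : G) (s : X.faces) (v : (s : Finset V)) : ((g • s : X.faces) : Finset V) :=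
  ⟨g • (v : V), smul_mem_smul_face v.2⟩

theorem smul_ofSimplex (g : G) (s : X.faces) (p : stdSimplex ℝ (s : Finset V)) :
    g • Realization.ofSimplex X s p =
      Realization.ofSimplex X (g • s) (stdSimplex.map (smulVertex g s) p) := by
  classical
  refine Realization.ext (Finsupp.ext fun v => ?_)
  rw [smul_coord]
  by_cases hv : g⁻¹ • v ∈ (s : Finset V)
  · rw [coord_ofSimplex_of_mem s p hv, coord_ofSimplex_of_mem _ _ (mem_smul_face.2 hv)]
    have hfiber : ({u | smulVertex g s u = ⟨v, mem_smul_face.2 hv⟩} : Finset (s : Finset V)) =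
        {⟨g⁻¹ • v, hv⟩} := by
      ext u
      simp [smulVertex, Subtype.ext_iff, eq_inv_smul_iff]
    change _ = FunOnFinite.linearMap ℝ ℝ (smulVertex g s) p _
    rw [FunOnFinite.linearMap_apply_apply, hfiber, Finset.sum_singleton]
    rfl
  · rw [coord_ofSimplex_of_notMem s p hv, coord_ofSimplex_of_notMem _ _ (mt mem_smul_face.1 hv)]

instance instContinuousConstSMulRealization : ContinuousConstSMul G X.Realization where
  continuous_const_smul g :=
    continuous_iSup_dom.2 fun s => continuous_coinduced_dom.2 <| by
      have hcomp : (g • ·) ∘ Realization.ofSimplex X s =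
          Realization.ofSimplex X (g • s) ∘ stdSimplex.map (smulVertex g s) :=
        funext (smul_ofSimplex g s)
      rw [hcomp]
      exact (continuous_iSup_rng (i := g • s) continuous_coinduced_rng).comp
        (stdSimplex.continuous_map _)

theorem smul_mem_barycentricStar (g : G) {s : X.faces} {x : X.Realization}
    (hx : x ∈ barycentricStar X s) : g • x ∈ barycentricStar X (g • s) := fun _ hv =>
  ⟨(hx _ (mem_smul_face.1 hv)).1, fun _ hw =>
    (hx _ (mem_smul_face.1 hv)).2 _ fun hw' => hw (mem_smul_face.2 hw')⟩

theorem smul_face_eq_of_mem_barycentricStar {g : G} {s : X.faces} {x : X.Realization}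
    (hx : x ∈ barycentricStar X s) (hgx : x ∈ barycentricStar X (g • s)) : g • s = s := by
  have hcard : ((g • s : X.faces) : Finset V).card = (s : Finset V).card := Finset.card_map _
  rcases subset_or_subset_of_mem_barycentricStar hx hgx with h | h
  · exact Subtype.ext (Finset.eq_of_subset_of_card_le h hcard.le).symm
  · exact Subtype.ext (Finset.eq_of_subset_of_card_le h hcard.ge)

variable (G X) in
theorem isSliceCover_barycentricStar : IsSliceCover G (barycentricStar X) where
  isOpen := isOpen_barycentricStar
  exists_mem x := ⟨_, mem_barycentricStar_support x⟩
  smul_mem g _ _ hx := smul_mem_barycentricStar g hx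
  smul_eq := smul_face_eq_of_mem_barycentricStar

end SimplicialAction

section Amalgam

variable {G V : Type*} [Group G] [MulAction G V] (X : AbstractSimplicialComplex V)

variable (G) in
/-- The quotient of the free product of the vertex stabilizers by the edge and conjugation
relations. -/
abbrev StabilizerAmalgam : Type _ :=
  StabilizerProduct V G ⧸ relatorSubgroup G X

/-- The canonical homomorphism from `G_v` to the amalgam. -/
def amalgamOf (v : V) : MulAction.stabilizer G v →* StabilizerAmalgam G X :=
  (QuotientGroup.mk' (relatorSubgroup G X)).comp
    (Monoid.CoprodI.of (M := fun v : V => MulAction.stabilizer G v) (i := v))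

variable (G) in
/-- The homomorphism from the amalgam to `G` that restricts to the inclusion on every vertex
stabilizer. -/
def amalgamToGroup : StabilizerAmalgam G X →* G :=
  QuotientGroup.lift (relatorSubgroup G X)
    (Monoid.CoprodI.lift fun v : V => (MulAction.stabilizer G v).subtype) <|
      Subgroup.normalClosure_le_normal <| by
        rintro r (⟨e, _, -, v, -, v', -, -, g, -, hv, hv', rfl⟩ | ⟨v, w, g, h, rfl⟩)
        · simp [MonoidHom.mem_ker]
        · simp [MonoidHom.mem_ker, conjStab]

variable {X}

@[simp]
theorem amalgamToGroup_of (v : V) (g : MulAction.stabilizer G v) :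
    amalgamToGroup G X (amalgamOf X v g) = g := by
  change Monoid.CoprodI.lift (fun v : V => (MulAction.stabilizer G v).subtype) (stabElt v g) = _
  rw [Monoid.CoprodI.lift_of]
  rfl

theorem StabilizerAmalgam.induction_left {P : StabilizerAmalgam G X → Prop}
    (γ : StabilizerAmalgam G X) (one : P 1)
    (mul : ∀ v (g : MulAction.stabilizer G v) γ, P γ → P (amalgamOf X v g * γ)) : P γ := by
  induction γ using QuotientGroup.induction_on with | _ w =>
  induction w using Monoid.CoprodI.induction_left with
  | one => exact one
  | mul m x ih => exact mul _ m _ ih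

theorem amalgamOf_congr {v w : V} (hvw : v = w) {g : MulAction.stabilizer G v}
    {h : MulAction.stabilizer G w} (hgh : (g : G) = h) : amalgamOf X v g = amalgamOf X w h := by
  subst hvw
  rw [Subtype.ext hgh]

theorem amalgamOf_mul_amalgamOf_mul_inv (v w : V) (g : MulAction.stabilizer G v)
    (h : MulAction.stabilizer G w) :
    amalgamOf X v g * amalgamOf X w h * (amalgamOf X v g)⁻¹ =
      amalgamOf X ((g : G) • w) (conjStab (g : G) w h) := by
  rw [← mul_inv_eq_one]
  exact (QuotientGroup.eq_one_iff (N := relatorSubgroup G X) _).2 <|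
    Subgroup.subset_normalClosure (Or.inr ⟨v, w, g, h, rfl⟩)

theorem mul_amalgamOf_mul_inv (γ : StabilizerAmalgam G X) (w : V) (h : MulAction.stabilizer G w) :
    γ * amalgamOf X w h * γ⁻¹ =
      amalgamOf X (amalgamToGroup G X γ • w) (conjStab (amalgamToGroup G X γ) w h) := by
  induction γ using StabilizerAmalgam.induction_left with
  | one =>
    simp only [one_mul, inv_one, mul_one]
    exact amalgamOf_congr (by simp) (by simp [conjStab])
  | mul v g γ ih =>
    calc _ = amalgamOf X v g * (γ * amalgamOf X w h * γ⁻¹) * (amalgamOf X v g)⁻¹ := by group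
      _ = _ := by
        rw [ih, amalgamOf_mul_amalgamOf_mul_inv]
        refine amalgamOf_congr ?_ ?_
        · rw [map_mul, amalgamToGroup_of, mul_smul]
        · simp only [conjStab, map_mul, amalgamToGroup_of]
          group

theorem ker_amalgamToGroup_le_center :
    (amalgamToGroup G X).ker ≤ Subgroup.center (StabilizerAmalgam G X) := by
  intro k hk
  rw [MonoidHom.mem_ker] at hk
  have hgen : ∀ w (h : MulAction.stabilizer G w), amalgamOf X w h * k = k * amalgamOf X w h := by
    intro w h
    rw [eq_comm, ← mul_inv_eq_iff_eq_mul, mul_amalgamOf_mul_inv]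
    exact amalgamOf_congr (by rw [hk, one_smul]) (by simp [conjStab, hk])
  refine Subgroup.mem_center_iff.2 fun γ => ?_
  induction γ using StabilizerAmalgam.induction_left with
  | one => simp
  | mul v g γ ih => rw [mul_assoc, ih, ← mul_assoc, hgen, mul_assoc]

instance instNormalRangeAmalgamToGroup : (amalgamToGroup G X).range.Normal := by
  refine ⟨?_⟩
  rintro _ ⟨γ, rfl⟩ g
  induction γ using StabilizerAmalgam.induction_left with
  | one => simp
  | mul v h γ ih =>
    have hconj : g * amalgamToGroup G X (amalgamOf X v h * γ) * g⁻¹ =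
        amalgamToGroup G X (amalgamOf X (g • v) (conjStab g v h)) *
          (g * amalgamToGroup G X γ * g⁻¹) := by
      rw [map_mul, amalgamToGroup_of, amalgamToGroup_of, conjStab]
      group
    rw [hconj]
    exact mul_mem ⟨_, rfl⟩ ih

theorem amalgamOf_eq_self {v : V} {a : StabilizerAmalgam G X} (ha : a ∈ (amalgamOf X v).range)
    {g : MulAction.stabilizer G v} (hg : amalgamToGroup G X a = g) : amalgamOf X v g = a := by
  obtain ⟨h, rfl⟩ := ha
  exact congrArg _ (Subtype.ext (hg.symm.trans (amalgamToGroup_of v h)))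

theorem smul_eq_of_mem_range_amalgamOf {v : V} {a : StabilizerAmalgam G X}
    (ha : a ∈ (amalgamOf X v).range) : amalgamToGroup G X a • v = v := by
  obtain ⟨h, rfl⟩ := ha
  rw [amalgamToGroup_of]
  exact h.2

/-- The part of the amalgam that comes from all the stabilizers of vertices of the simplex `s`; it
projects isomorphically to the stabilizer of `s` if the action is without rotations. -/
def simplexSubgroup (s : X.faces) : Subgroup (StabilizerAmalgam G X) :=
  ⨅ v ∈ (s : Finset V), (amalgamOf X v).range

theorem mem_simplexSubgroup {s : X.faces} {a : StabilizerAmalgam G X} :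
    a ∈ simplexSubgroup s ↔ ∀ v ∈ (s : Finset V), a ∈ (amalgamOf X v).range := by
  simp only [simplexSubgroup, Subgroup.mem_iInf]

theorem eq_one_of_mem_simplexSubgroup {s : X.faces} {a : StabilizerAmalgam G X}
    (ha : a ∈ simplexSubgroup s) (h : amalgamToGroup G X a = 1) : a = 1 := by
  obtain ⟨v, hv⟩ := (X.isRelLowerSet_faces s.2).1
  rw [← amalgamOf_eq_self (mem_simplexSubgroup.1 ha v hv) (g := 1) h, map_one]

variable [IsSimplicialAction G X]

theorem conj_mem_simplexSubgroup (γ : StabilizerAmalgam G X) {s : X.faces}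
    {a : StabilizerAmalgam G X} (ha : a ∈ simplexSubgroup s) :
    γ * a * γ⁻¹ ∈ simplexSubgroup (amalgamToGroup G X γ • s) := by
  refine mem_simplexSubgroup.2 fun w hw => ?_
  obtain ⟨v, hv, rfl⟩ := Finset.mem_map.1 hw
  obtain ⟨h, rfl⟩ := mem_simplexSubgroup.1 ha v hv
  exact ⟨_, (mul_amalgamOf_mul_inv γ v h).symm⟩

end Amalgam

section WithoutRotations

variable {G V : Type*} [Group G] [MulAction G V] {X : AbstractSimplicialComplex V}
  [IsSimplicialAction G X]

theorem smul_vertex_eq (hrot : WithoutRotations G X) {s : X.faces} {g : G} (hg : g • s = s) {v : V}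
    (hv : v ∈ (s : Finset V)) : g • v = v :=
  hrot s s.2 g (congrArg Subtype.val hg) v hv

theorem amalgamOf_eq_amalgamOf (hrot : WithoutRotations G X) {s : X.faces} {g : G} (hg : g • s = s)
    {v w : V} (hv : v ∈ (s : Finset V)) (hw : w ∈ (s : Finset V)) :
    amalgamOf X v ⟨g, smul_vertex_eq hrot hg hv⟩ =
      amalgamOf X w ⟨g, smul_vertex_eq hrot hg hw⟩ := by
  classical
  by_cases hvw : v = w
  · exact amalgamOf_congr hvw rfl
  rw [← mul_inv_eq_one]
  refine (QuotientGroup.eq_one_iff (N := relatorSubgroup G X) _).2 <|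
    Subgroup.subset_normalClosure <| Or.inl ⟨{v, w}, (X.isRelLowerSet_faces s.2).2 ?_ (by simp),
      Finset.card_pair hvw, v, by simp, w, by simp, hvw, g, ?_, _, _, rfl⟩
  · exact Finset.insert_subset hv (Finset.singleton_subset_iff.2 hw)
  · simp [Finset.map_insert, smul_vertex_eq hrot hg hv, smul_vertex_eq hrot hg hw]

theorem map_simplexSubgroup (hrot : WithoutRotations G X) (s : X.faces) :
    (simplexSubgroup s).map (amalgamToGroup G X) = MulAction.stabilizer G s := by
  refine le_antisymm ?_ fun g hg => ?_
  · rintro _ ⟨a, ha, rfl⟩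
    refine Subtype.ext <| Finset.map_eq_of_subset fun w hw => ?_
    obtain ⟨v, hv, rfl⟩ := Finset.mem_map.1 hw
    rwa [Equiv.coe_toEmbedding, MulAction.toPerm_apply,
      smul_eq_of_mem_range_amalgamOf (mem_simplexSubgroup.1 ha v hv)]
  · obtain ⟨v, hv⟩ := (X.isRelLowerSet_faces s.2).1
    exact ⟨amalgamOf X v ⟨g, smul_vertex_eq hrot hg hv⟩, mem_simplexSubgroup.2 fun w hw =>
      ⟨_, amalgamOf_eq_amalgamOf hrot hg hw hv⟩, amalgamToGroup_of _ _⟩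

theorem isStabilizerLift_simplexSubgroup (hrot : WithoutRotations G X) :
    IsStabilizerLift (amalgamToGroup G X) simplexSubgroup (barycentricStar X) where
  map_eq := map_simplexSubgroup hrot
  eq_one := eq_one_of_mem_simplexSubgroup
  conj_mem := conj_mem_simplexSubgroup
  mem_of_mem {s t a x} hs ht ha hat := by
    rcases subset_or_subset_of_mem_barycentricStar hs ht with hst | hts
    · obtain ⟨b, hb, hab⟩ := (map_simplexSubgroup hrot t).ge hat
      have hbs : b ∈ simplexSubgroup s :=
        mem_simplexSubgroup.2 fun v hv => mem_simplexSubgroup.1 hb v (hst hv)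
      have hone : a * b⁻¹ = 1 := eq_one_of_mem_simplexSubgroup (mul_mem ha (inv_mem hbs)) <| by
        rw [map_mul, map_inv, hab, mul_inv_cancel]
      rwa [mul_inv_eq_one.1 hone]
    · exact mem_simplexSubgroup.2 fun v hv => mem_simplexSubgroup.1 ha v (hts hv)

/-- The fixed point of `g_v` is the vertex `v`, which lies in no other star than its own. -/
theorem closure_fixing_eq_top :
    Subgroup.closure {η : StabilizerAmalgam G X | ∃ z : X.Realization,
      amalgamToGroup G X η • z = z ∧ ∀ s, z ∈ barycentricStar X s → η ∈ simplexSubgroup s} = ⊤ := by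
  refine (Subgroup.eq_top_iff' _).2 fun γ => ?_
  induction γ using StabilizerAmalgam.induction_left with
  | one => exact one_mem _
  | mul v g γ ih =>
    refine mul_mem (Subgroup.subset_closure ⟨vertexPoint X v, ?_, fun s hs => ?_⟩) ih
    · rw [amalgamToGroup_of, smul_vertexPoint, g.2]
    · refine mem_simplexSubgroup.2 fun w hw => ?_
      rw [eq_of_vertexPoint_mem_barycentricStar hs hw]
      exact ⟨g, rfl⟩

theorem amalgamToGroup_surjective (hrot : WithoutRotations G X) [PathConnectedSpace X.Realization]
    [SimplyConnectedSpace (OrbitSpace G X)] : Function.Surjective (amalgamToGroup G X) :=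
  MonoidHom.range_eq_top.1 <| (isSliceCover_barycentricStar G X).eq_top_of_stabilizer_le _
    fun s => (map_simplexSubgroup hrot s).ge.trans <| Subgroup.map_le_range _ _

theorem amalgamToGroup_injective (hrot : WithoutRotations G X) [SimplyConnectedSpace X.Realization]
    (hquot : IsTwoConnected (OrbitSpace G X)) : Function.Injective (amalgamToGroup G X) :=
  have := hquot.simplyConnected
  (isStabilizerLift_simplexSubgroup hrot).injective (isSliceCover_barycentricStar G X) hquot
    (amalgamToGroup_surjective hrot) ker_amalgamToGroup_le_center closure_fixing_eq_top

end WithoutRotations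

/-- If `G` acts without rotations on a simply connected simplicial complex `X` and `X/G` is
`2`-connected, then the homomorphism from the free product of all vertex stabilizers to `G` that
sends `g_v` to `g` induces an isomorphism of the quotient by the edge relations and the
conjugation relations with `G`. -/
theorem theorem1p1 {G V : Type*} [Group G] [MulAction G V]
    (X : AbstractSimplicialComplex V) [IsSimplicialAction G X]
    (hrot : WithoutRotations G X)
    (hX : SimplyConnectedSpace X.Realization)
    (hquot : IsTwoConnected (OrbitSpace G X)) :
    ∃ e : StabilizerProduct V G ⧸ relatorSubgroup G X ≃* G,
      ∀ (v : V) (g : MulAction.stabilizer G v),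
        e (QuotientGroup.mk (stabElt v g)) = (g : G) := by
  have := hquot.simplyConnected
  exact ⟨MulEquiv.ofBijective (amalgamToGroup G X)
    ⟨amalgamToGroup_injective hrot hquot, amalgamToGroup_surjective hrot⟩,
      amalgamToGroup_of (X := X)⟩
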